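/- Let $X$ be a Fano manifold of dimension $n$ over $\mathbb{C}$, that is, a connected smooth proper complex variety whose anticanonical bundle $-K_X$ is ample. If $(X,-K_X)$ is asymptotically Chow polystable (resp. asymptotically Chow stable, asymptotically Chow semistable), then $X$ is asymptotically F-polystable (resp. asymptotically F-stable, asymptotically F-semistable). The notions are as follows. A *test configuration* $(\mathcal X,\mathcal L)$ of exponent $k\ge 1$ for $(X,-K_X)$ is a scheme $\mathcal X$ with a $\mathbb{C}^*$-action, a flat proper morphism $\pi\colon\mathcal X\to\mathbb{C}$ that is equivariant for the multiplication action on $\mathbb{C}$, a $\pi$-very ample $\mathbb{C}^*$-linearized line bundle $\mathcal L$ on $\mathcal X$, and an isomorphism $(\mathcal X_1,\mathcal L_1)\cong(X,-kK_X)$. It is a *product* configuration if $\mathcal X\cong X\times\mathbb{C}$ over $\mathbb{C}$, and a *trivial* configuration if in addition $\mathbb{C}^*$ acts on the second factor only. Let $N_{km}=\dim H^0(\mathcal X_0,\mathcal L_0^{\otimes m})$ and let $w_{km}$ be the total weight of the $\mathbb{C}^*$-action on $H^0(\mathcal X_0,\mathcal L_0^{\otimes m})$; write, for large $m$, $$N_{km}=a_0(km)^n+a_1(km)^{n-1}+\cdots+a_n,\qquad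 w_{km}=b_0(km)^{n+1}+b_1(km)^n+\cdots+b_{n+1}$$ (with $a_1=0$ if $n=0$), and set $$\mathrm{Chow}_k(\mathcal X,\mathcal L)=\frac{b_0}{a_0}-\frac{w_k}{kN_k},\qquad DF(\mathcal X,\mathcal L)=2\,\frac{a_1b_0-a_0b_1}{a_0^2},\qquad \mathrm{Fut}_k(\mathcal X,\mathcal L)=kN_k\bigl(DF(\mathcal X,\mathcal L)+\mathrm{Chow}_k(\mathcal X,\mathcal L)\bigr).$$ Then $(X,-K_X)$ is *Chow semistable at level $k$* if $\mathrm{Chow}_k(\mathcal X,\mathcal L)\ge 0$ for every test configuration of exponent $k$. It is *Chow polystable* (resp. *Chow stable*) *at level $k$* if it is Chow semistable at level $k$ and, for every test configuration of exponent $k$, $\mathrm{Chow}_k(\mathcal X,\mathcal L)=0$ if and only if $(\mathcal X,\mathcal L)$ is a product (resp. trivial) configuration. *F-semistability, F-polystability and F-stability at level $k$* of $X$ are defined in the same way, with $\mathrm{Fut}_k$ in place of $\mathrm{Chow}_k$. Each property holds *asymptotically* if there is a $k_0>0$ such that it holds at every level $k\ge k_0$. -/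

import Mathlib

open AlgebraicGeometry CategoryTheory

namespace FanoStability

noncomputable section

/-! ## Functions on schemes -/

/-- The complex point. -/
abbrev SpecC : Scheme.{0} := Spec (CommRingCat.of ℂ)

/-- Restriction of functions to a smaller open subset. -/
def res {X : Scheme.{0}} {V W : X.Opens} (h : W ≤ V) : Γ(X, V) →+* Γ(X, W) :=
  (X.presheaf.map (homOfLE h).op).hom

/-- Pull-back of functions along `f`, from an open subset `V` to an open subset `W ≤ f⁻¹ V`. -/
def pull {X Y : Scheme.{0}} (f : X ⟶ Y) {V : Y.Opens} {W : X.Opens} (h : W ≤ f ⁻¹ᵁ V) :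
    Γ(Y, V) →+* Γ(X, W) :=
  (f.appLE V W h).hom

theorem res_res {X : Scheme.{0}} {U V W : X.Opens} (h : V ≤ U) (h' : W ≤ V) (s : Γ(X, U)) :
    res h' (res h s) = res (h'.trans h) s := by
  have : X.presheaf.map (homOfLE h).op ≫ X.presheaf.map (homOfLE h').op =
      X.presheaf.map (homOfLE (h'.trans h)).op := by
    rw [← Functor.map_comp]; rfl
  exact congr($(this).hom s)

theorem res_pull {X Y : Scheme.{0}} (f : X ⟶ Y) {V : Y.Opens} {W W' : X.Opens}
    (h : W ≤ f ⁻¹ᵁ V) (h' : W' ≤ W) (s : Γ(Y, V)) :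
    res h' (pull f h s) = pull f (h'.trans h) s := by
  have := Scheme.Hom.appLE_map f h (homOfLE h').op
  exact congr($(this).hom s)

theorem pull_res {X Y : Scheme.{0}} (f : X ⟶ Y) {V V' : Y.Opens} {W : X.Opens}
    (h' : V' ≤ V) (h : W ≤ f ⁻¹ᵁ V') (s : Γ(Y, V)) :
    pull f h (res h' s) = pull f (h.trans (f.preimage_mono h')) s := by
  have := Scheme.Hom.map_appLE f h (homOfLE h').op
  exact congr($(this).hom s)

theorem pull_pull {X Y Z : Scheme.{0}} (f : X ⟶ Y) (g : Y ⟶ Z) {U : Z.Opens} {V : Y.Opens}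
    {W : X.Opens} (h : V ≤ g ⁻¹ᵁ U) (h' : W ≤ f ⁻¹ᵁ V) (s : Γ(Z, U)) :
    pull f h' (pull g h s) = pull (f ≫ g) (h'.trans (f.preimage_mono h)) s := by
  have := Scheme.Hom.appLE_comp_appLE f g U V W h h'
  exact congr($(this).hom s)

theorem le_preimage_inf {X Y : Scheme.{0}} {f : X ⟶ Y} {U V : Y.Opens} {W : X.Opens}
    (hU : W ≤ f ⁻¹ᵁ U) (hV : W ≤ f ⁻¹ᵁ V) : W ≤ f ⁻¹ᵁ (U ⊓ V) := le_inf hU hV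

theorem le_preimage_comp {X Y Z : Scheme.{0}} {f : X ⟶ Y} {g : Y ⟶ Z} {U : Z.Opens}
    {W : X.Opens} (h : W ≤ f ⁻¹ᵁ g ⁻¹ᵁ U) : W ≤ (f ≫ g) ⁻¹ᵁ U := h

/-- Pull-back of invertible functions on all of `T` along `p : T' ⟶ T`. -/
def pullUnit {T' T : Scheme.{0}} (p : T' ⟶ T) : Γ(T, ⊤)ˣ →* Γ(T', ⊤)ˣ :=
  Units.map (p.appTop.hom : Γ(T, ⊤) →* Γ(T', ⊤))

/-- The ring `𝒪_X(U)`, for a scheme `X` over `ℂ` with structure morphism `f`; the morphism is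
recorded in the type so that the ring is a `ℂ`-algebra. -/
def Fn {X : Scheme.{0}} (_f : X ⟶ SpecC) (U : X.Opens) : Type := Γ(X, U)

/-- The constant functions on `U`. -/
def const {X : Scheme.{0}} (f : X ⟶ SpecC) (U : X.Opens) : ℂ →+* Γ(X, U) :=
  (pull f (V := ⊤) le_top).comp (Scheme.ΓSpecIso (CommRingCat.of ℂ)).inv.hom

instance {X : Scheme.{0}} (f : X ⟶ SpecC) (U : X.Opens) : CommRing (Fn f U) :=
  inferInstanceAs (CommRing Γ(X, U))

instance {X : Scheme.{0}} (f : X ⟶ SpecC) (U : X.Opens) : Algebra ℂ (Fn f U) :=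
  RingHom.toAlgebra (const f U)

theorem res_const {X : Scheme.{0}} (f : X ⟶ SpecC) {V W : X.Opens} (h : W ≤ V) (c : ℂ) :
    res h (const f V c) = const f W c := by
  exact res_pull f le_top h _

theorem pull_const {T X : Scheme.{0}} (x : T ⟶ X) (f : X ⟶ SpecC) {V : X.Opens} {W : T.Opens}
    (h : W ≤ x ⁻¹ᵁ V) (c : ℂ) : pull x h (const f V c) = const (x ≫ f) W c := by
  exact pull_pull x f le_top h _

/-! ## Line bundles -/

/-- A line bundle on `X`, given by an open cover `U i` and transition functions `g i j`, which are
invertible functions on `U i ∩ U j` with `g i j * g j k = g i k`.  A section is a family of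
functions `s i` on `U i` with `s i = g i j * s j`; equivalently the local frames `e i`, in terms of
which the section is `s i • e i`, satisfy `e j = g i j • e i`. -/
structure LineBundle (X : Scheme.{0}) where
  ι : Type
  U : ι → X.Opens
  iSup_U : ⨆ i, U i = ⊤
  g : ∀ i j, Γ(X, U i ⊓ U j)ˣ
  cocycle : ∀ (i j k : ι) (W : X.Opens) (hi : W ≤ U i) (hj : W ≤ U j) (hk : W ≤ U k),
    res (le_inf hi hj) (g i j : Γ(X, U i ⊓ U j)) * res (le_inf hj hk) (g j k : Γ(X, U j ⊓ U k)) =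
      res (le_inf hi hk) (g i k : Γ(X, U i ⊓ U k))

namespace LineBundle

variable {X Y : Scheme.{0}}

/-- The tensor power `L^{⊗ m}`, which has the transition functions `g i j ^ m`. -/
def pow (L : LineBundle X) (m : ℕ) : LineBundle X where
  ι := L.ι
  U := L.U
  iSup_U := L.iSup_U
  g i j := L.g i j ^ m
  cocycle i j k W hi hj hk := by
    simp only [Units.val_pow_eq_pow_val, map_pow]
    rw [← mul_pow, L.cocycle i j k W hi hj hk]

/-- The pull-back of a line bundle along `f : Y ⟶ X`. -/
def pullback (L : LineBundle X) (f : Y ⟶ X) : LineBundle Y where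
  ι := L.ι
  U i := f ⁻¹ᵁ L.U i
  iSup_U := by
    rw [← Scheme.Hom.preimage_iSup, L.iSup_U]
    rfl
  g i j := Units.map (pull f (V := L.U i ⊓ L.U j) (W := f ⁻¹ᵁ L.U i ⊓ f ⁻¹ᵁ L.U j)
    (le_preimage_inf inf_le_left inf_le_right) :
    Γ(X, L.U i ⊓ L.U j) →* Γ(Y, f ⁻¹ᵁ L.U i ⊓ f ⁻¹ᵁ L.U j)) (L.g i j)
  cocycle i j k W hi hj hk := by
    have h := congrArg (pull f (W := W) (le_preimage_inf (le_preimage_inf hi hj) hk))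
      (L.cocycle i j k (L.U i ⊓ L.U j ⊓ L.U k) (inf_le_left.trans inf_le_left)
        (inf_le_left.trans inf_le_right) inf_le_right)
    rw [map_mul, pull_res, pull_res, pull_res] at h
    refine (congrArg₂ (· * ·) (res_pull f _ _ _) (res_pull f _ _ _)).trans (h.trans ?_)
    exact (res_pull f _ _ _).symm

/-- An isomorphism of line bundles `L ≅ M`.  In terms of the local frames it is given by the
invertible functions `h i j` on `U_L i ∩ U_M j` with `e_L i ↦ h i j • e_M j`; so the section
`(s i)` of `L` goes to the section of `M` with components `h i j * s i`. -/
structure Iso (L M : LineBundle X) where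
  h : ∀ i j, Γ(X, L.U i ⊓ M.U j)ˣ
  left : ∀ (i i' : L.ι) (j : M.ι) (W : X.Opens) (hi : W ≤ L.U i) (hi' : W ≤ L.U i')
    (hj : W ≤ M.U j),
    res (le_inf hi' hj) (h i' j : Γ(X, L.U i' ⊓ M.U j)) =
      res (le_inf hi hj) (h i j : Γ(X, L.U i ⊓ M.U j)) *
        res (le_inf hi hi') (L.g i i' : Γ(X, L.U i ⊓ L.U i'))
  right : ∀ (i : L.ι) (j j' : M.ι) (W : X.Opens) (hi : W ≤ L.U i) (hj : W ≤ M.U j)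
    (hj' : W ≤ M.U j'),
    res (le_inf hi hj) (h i j : Γ(X, L.U i ⊓ M.U j)) =
      res (le_inf hj hj') (M.g j j' : Γ(X, M.U j ⊓ M.U j')) *
        res (le_inf hi hj') (h i j' : Γ(X, L.U i ⊓ M.U j'))

end LineBundle

/-- The complex vector space `H⁰(X, L)` of global sections. -/
def H0 {X : Scheme.{0}} (f : X ⟶ SpecC) (L : LineBundle X) :
    Submodule ℂ (∀ i, Fn f (L.U i)) where
  carrier := {s | ∀ i j, res inf_le_left (s i : Γ(X, L.U i)) =
    (L.g i j : Γ(X, L.U i ⊓ L.U j)) * res inf_le_right (s j : Γ(X, L.U j))}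
  zero_mem' i j := (map_zero (res _)).trans
    ((mul_zero (L.g i j : Γ(X, L.U i ⊓ L.U j))).symm.trans
      (congrArg _ (map_zero (res inf_le_right)).symm))
  add_mem' {s t} hs ht i j := by
    refine (map_add (res inf_le_left) (s i : Γ(X, L.U i)) (t i)).trans ?_
    refine (congrArg₂ (· + ·) (hs i j) (ht i j)).trans ?_
    refine (mul_add _ _ _).symm.trans (congrArg _ ?_)
    exact (map_add (res inf_le_right) (s j : Γ(X, L.U j)) (t j)).symm
  smul_mem' c s hs i j := by
    refine (map_mul (res inf_le_left) (const f (L.U i) c) (s i : Γ(X, L.U i))).trans ?_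
    refine (congrArg₂ (· * ·) (res_const f _ c) (hs i j)).trans ?_
    refine (mul_left_comm _ _ _).trans (congrArg _ ?_)
    exact ((map_mul (res inf_le_right) (const f (L.U j) c) (s j : Γ(X, L.U j))).trans
      (congrArg₂ (· * ·) (res_const f _ c) rfl)).symm

/-! ## Projective space and very ample line bundles -/

section Proj

open MvPolynomial HomogeneousLocalization

/-- The ring `R[X_0, …, X_N]`, graded by the degree. -/
abbrev grading (R : Type) [CommRing R] (N : ℕ) :
    ℕ → Submodule R (MvPolynomial (Fin (N + 1)) R) :=
  homogeneousSubmodule (Fin (N + 1)) R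

instance (R : Type) [CommRing R] (N : ℕ) : GradedRing (grading R N) :=
  MvPolynomial.gradedAlgebra

/-- Projective space `ℙ^N` over a ring. -/
def ProjectiveSpace (R : Type) [CommRing R] (N : ℕ) : Scheme.{0} := Proj (grading R N)

/-- The structure morphism `ℙ^N_R ⟶ Spec R`. -/
def ProjectiveSpace.toBase (R : Type) [CommRing R] (N : ℕ) :
    ProjectiveSpace R N ⟶ Spec (CommRingCat.of R) :=
  Proj.toSpecZero (grading R N) ≫ Spec.map (CommRingCat.ofHom (algebraMap R (grading R N 0)))

/-- The standard open subset `X_a ≠ 0` of `ℙ^N`. -/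
def ProjectiveSpace.chart (R : Type) [CommRing R] (N : ℕ) (a : Fin (N + 1)) :
    (ProjectiveSpace R N).Opens := Proj.basicOpen (grading R N) (X a)

/-- The function `X_b / X_a` on `X_a ≠ 0`. -/
def ProjectiveSpace.ratio (R : Type) [CommRing R] (N : ℕ) (a b : Fin (N + 1)) :
    Γ(ProjectiveSpace R N, ProjectiveSpace.chart R N a) :=
  (Proj.awayToSection (grading R N) (X a)).hom
    (Away.mk (grading R N) (d := 1) (isHomogeneous_X R a) 1 (X b) (isHomogeneous_X R b))

theorem ProjectiveSpace.ratio_self (R : Type) [CommRing R] (N : ℕ) (a : Fin (N + 1)) :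
    ratio R N a a = 1 := by
  have : Away.mk (grading R N) (d := 1) (isHomogeneous_X R a) 1 (X a) (isHomogeneous_X R a) =
      1 := by
    apply HomogeneousLocalization.val_injective
    refine Eq.trans ?_ (HomogeneousLocalization.val_one (𝒜 := grading R N)).symm
    refine (show _ = Localization.mk (X a : MvPolynomial (Fin (N + 1)) R)
      (⟨X a ^ 1, 1, rfl⟩ : Submonoid.powers (X a : MvPolynomial (Fin (N + 1)) R)) from rfl).trans ?_
    simp only [pow_one]
    exact Localization.mk_self
      (⟨X a, 1, pow_one _⟩ : Submonoid.powers (X a : MvPolynomial (Fin (N + 1)) R))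
  exact (congrArg _ this).trans (map_one _)

theorem ProjectiveSpace.ratio_mul (R : Type) [CommRing R] (N : ℕ) (a b c : Fin (N + 1))
    {W : (ProjectiveSpace R N).Opens} (ha : W ≤ chart R N a) (hb : W ≤ chart R N b) :
    res ha (ratio R N a b) * res hb (ratio R N b c) = res ha (ratio R N a c) := by
  have key (a b : Fin (N + 1)) (h : W ≤ chart R N a) (p : (W : TopologicalSpace.Opens (ProjectiveSpectrum.top (grading R N)))) :
      haveI := p.1.isPrime
      (((res h (ratio R N a b) :) : (ProjectiveSpectrum.Proj.structureSheaf (grading R N)).1.obj (.op W)).1 p).val =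
        Localization.mk (X b) (⟨X a, h p.2⟩ : (HomogeneousIdeal.toIdeal p.1.asHomogeneousIdeal).primeCompl) := by
    have := p.1.isPrime
    have h1 : X a ^ 1 ∈ (HomogeneousIdeal.toIdeal p.1.asHomogeneousIdeal).primeCompl := by
      rw [pow_one]; exact h p.2
    refine (show _ = Localization.mk (X b) ⟨X a ^ 1, h1⟩ from rfl).trans ?_
    simp only [pow_one]
  refine Subtype.ext (funext fun p => HomogeneousLocalization.val_injective _ ?_)
  refine (HomogeneousLocalization.val_mul _ _).trans ?_
  refine (congrArg₂ (· * ·) (key a b ha p) (key b c hb p)).trans (.trans ?_ (key a c ha p).symm)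
  rw [Localization.mk_mul, Localization.mk_eq_mk_iff, Localization.r_iff_exists]
  exact ⟨1, by simp; ring⟩

/-- The line bundle `𝒪(1)` on `ℙ^N`, with the frames `X_a` on `X_a ≠ 0`. -/
def ProjectiveSpace.O1 (R : Type) [CommRing R] (N : ℕ) : LineBundle (ProjectiveSpace R N) where
  ι := Fin (N + 1)
  U := chart R N
  iSup_U := by
    refine Proj.iSup_basicOpen_eq_top' (grading R N) (fun a => X a)
      (fun a => ⟨1, isHomogeneous_X R a⟩) ?_
    refine top_le_iff.mp fun p _ => ?_
    have hp : p ∈ Algebra.adjoin R (Set.range (X : Fin (N + 1) → MvPolynomial (Fin (N + 1)) R)) := by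
      rw [adjoin_range_X]; trivial
    induction hp using Algebra.adjoin_induction with
    | mem x hx => exact Algebra.subset_adjoin hx
    | algebraMap r => exact Subalgebra.algebraMap_mem _ (algebraMap R (grading R N 0) r)
    | add x y _ _ hx hy => exact add_mem (hx trivial) (hy trivial)
    | mul x y _ _ hx hy => exact mul_mem (hx trivial) (hy trivial)
  g a b :=
    { val := res inf_le_left (ratio R N a b)
      inv := res inf_le_right (ratio R N b a)
      val_inv := by rw [ratio_mul, ratio_self, map_one]
      inv_val := by rw [ratio_mul, ratio_self, map_one] }
  cocycle a b c W ha hb hc := by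
    simp only [res_res]
    exact ratio_mul R N a b c ha hb

end Proj

/-- A line bundle `L` on `Y` is very ample relative to the proper morphism `p : Y ⟶ Spec R` if it
is the restriction of `𝒪(1)` under a closed embedding of `Y` into some `ℙ^N_R` over `R`. -/
def VeryAmple {R : Type} [CommRing R] {Y : Scheme.{0}} (p : Y ⟶ Spec (CommRingCat.of R))
    (L : LineBundle Y) : Prop :=
  ∃ (N : ℕ) (e : Y ⟶ ProjectiveSpace R N), IsClosedImmersion e ∧
    e ≫ ProjectiveSpace.toBase R N = p ∧
    Nonempty (LineBundle.Iso ((ProjectiveSpace.O1 R N).pullback e) L)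

/-- A line bundle on a proper complex scheme is ample if a positive power of it is very ample. -/
def Ample {X : Scheme.{0}} (f : X ⟶ SpecC) (L : LineBundle X) : Prop :=
  ∃ k : ℕ, 0 < k ∧ VeryAmple f (L.pow k)

/-! ## Fano manifolds -/

/-- The sections of `⋀ⁿ T_X` over an affine open subset `V`, as the alternating `n`-linear forms
on the module of Kähler differentials of `𝒪_X(V)`. -/
abbrev Polyvector {X : Scheme.{0}} (f : X ⟶ SpecC) (n : ℕ) (V : X.Opens) : Type :=
  Ω[Fn f V⁄ℂ] [⋀^Fin n]→ₗ[Fn f V] Fn f V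

/-- An isomorphism of the line bundle `L` with `⋀ⁿ T_X`, which is `-K_X` if `X` is smooth of
dimension `n`.  It is given by the polyvector fields `θ i` on `U i` to which the local frames of
`L` correspond: on each affine open subset of `U i` the polyvector field `θ i` freely generates
`⋀ⁿ T_X`, and `θ j = g i j • θ i` on `U i ∩ U j`. -/
structure AnticanonicalIso {X : Scheme.{0}} (f : X ⟶ SpecC) (n : ℕ) (L : LineBundle X) where
  θ : ∀ (i : L.ι) (V : X.Opens), IsAffineOpen V → V ≤ L.U i → Polyvector f n V
  restrict : ∀ (i : L.ι) (V W : X.Opens) (hV : IsAffineOpen V) (hW : IsAffineOpen W)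
    (hVU : V ≤ L.U i) (hWV : W ≤ V) (r : Fin n → Γ(X, V)),
    θ i W hW (hWV.trans hVU) (fun l => KaehlerDifferential.D ℂ (Fn f W) (res hWV (r l))) =
      res hWV (θ i V hV hVU (fun l => KaehlerDifferential.D ℂ (Fn f V) (r l)))
  generates : ∀ (i : L.ι) (V : X.Opens) (hV : IsAffineOpen V) (hVU : V ≤ L.U i)
    (ω : Polyvector f n V), ∃! a : Fn f V, ω = a • θ i V hV hVU
  transition : ∀ (i j : L.ι) (V : X.Opens) (hV : IsAffineOpen V) (hi : V ≤ L.U i)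
    (hj : V ≤ L.U j),
    θ j V hV hj = (show Fn f V from res (le_inf hi hj) (L.g i j : Γ(X, L.U i ⊓ L.U j))) • θ i V hV hi

/-- `X` is a Fano manifold of dimension `n`: a connected smooth proper complex variety whose
anticanonical line bundle `-K_X` is ample.  The argument `A` is (a model of) `-K_X`. -/
structure IsFanoManifold {X : Scheme.{0}} (f : X ⟶ SpecC) (n : ℕ) (A : LineBundle X) : Prop where
  smooth : SmoothOfRelativeDimension n f
  proper : IsProper f
  connected : ConnectedSpace X
  anticanonical : Nonempty (AnticanonicalIso f n A)
  ample : Ample f A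

/-! ## Actions of `ℂ^*` -/

/-- An action of the algebraic group `ℂ^* = 𝔾_m` on a complex scheme `Y`, by its functor of points:
for each scheme `T` over `Y` (hence over `ℂ`), the group `𝔾_m(T)` of invertible functions on `T`
acts on the set `Y(T)`, functorially in `T`. -/
structure GmAction {Y : Scheme.{0}} (f : Y ⟶ SpecC) where
  act : ∀ {T : Scheme.{0}}, Γ(T, ⊤)ˣ → (T ⟶ Y) → (T ⟶ Y)
  act_over : ∀ {T : Scheme.{0}} (u : Γ(T, ⊤)ˣ) (x : T ⟶ Y), act u x ≫ f = x ≫ f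
  natural : ∀ {T' T : Scheme.{0}} (p : T' ⟶ T) (u : Γ(T, ⊤)ˣ) (x : T ⟶ Y),
    p ≫ act u x = act (pullUnit p u) (p ≫ x)
  one_act : ∀ {T : Scheme.{0}} (x : T ⟶ Y), act 1 x = x
  mul_act : ∀ {T : Scheme.{0}} (v u : Γ(T, ⊤)ˣ) (x : T ⟶ Y), act (v * u) x = act v (act u x)

/-- A linearization of the line bundle `L`, that is, a lift of the action on `Y` to `L`, linear on
the fibres.  The element `u` maps the fibre `L_x` to `L_{u x}`; when `x` lies in `U i` and `u x`
lies in `U j`, this map is `e i (x) ↦ h i j u x • e j (u x)` in terms of the local frames. -/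
structure Linearization {Y : Scheme.{0}} {f : Y ⟶ SpecC} (ρ : GmAction f) (L : LineBundle Y) where
  h : ∀ (i j : L.ι) {T : Scheme.{0}} (u : Γ(T, ⊤)ˣ) (x : T ⟶ Y), ⊤ ≤ x ⁻¹ᵁ L.U i →
    ⊤ ≤ ρ.act u x ⁻¹ᵁ L.U j → Γ(T, ⊤)ˣ
  natural : ∀ (i j : L.ι) {T' T : Scheme.{0}} (p : T' ⟶ T) (u : Γ(T, ⊤)ˣ) (x : T ⟶ Y)
    (hi : ⊤ ≤ x ⁻¹ᵁ L.U i) (hj : ⊤ ≤ ρ.act u x ⁻¹ᵁ L.U j) (hi' : ⊤ ≤ (p ≫ x) ⁻¹ᵁ L.U i)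
    (hj' : ⊤ ≤ ρ.act (pullUnit p u) (p ≫ x) ⁻¹ᵁ L.U j),
    h i j (pullUnit p u) (p ≫ x) hi' hj' = pullUnit p (h i j u x hi hj)
  left : ∀ (i i' j : L.ι) {T : Scheme.{0}} (u : Γ(T, ⊤)ˣ) (x : T ⟶ Y)
    (hi : ⊤ ≤ x ⁻¹ᵁ L.U i) (hi' : ⊤ ≤ x ⁻¹ᵁ L.U i') (hj : ⊤ ≤ ρ.act u x ⁻¹ᵁ L.U j),
    (h i' j u x hi' hj : Γ(T, ⊤)) =
      h i j u x hi hj * pull x (V := L.U i ⊓ L.U i') (le_preimage_inf hi hi') (L.g i i')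
  right : ∀ (i j j' : L.ι) {T : Scheme.{0}} (u : Γ(T, ⊤)ˣ) (x : T ⟶ Y)
    (hi : ⊤ ≤ x ⁻¹ᵁ L.U i) (hj : ⊤ ≤ ρ.act u x ⁻¹ᵁ L.U j) (hj' : ⊤ ≤ ρ.act u x ⁻¹ᵁ L.U j'),
    (h i j u x hi hj : Γ(T, ⊤)) =
      pull (ρ.act u x) (V := L.U j ⊓ L.U j') (le_preimage_inf hj hj') (L.g j j') * h i j' u x hi hj'
  mul : ∀ (i j k : L.ι) {T : Scheme.{0}} (v u : Γ(T, ⊤)ˣ) (x : T ⟶ Y)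
    (hi : ⊤ ≤ x ⁻¹ᵁ L.U i) (hj : ⊤ ≤ ρ.act u x ⁻¹ᵁ L.U j)
    (hk : ⊤ ≤ ρ.act v (ρ.act u x) ⁻¹ᵁ L.U k) (hk' : ⊤ ≤ ρ.act (v * u) x ⁻¹ᵁ L.U k),
    h i k (v * u) x hi hk' = h j k v (ρ.act u x) hj hk * h i j u x hi hj

/-- The induced linearization of `L^{⊗ m}`. -/
def Linearization.pow {Y : Scheme.{0}} {f : Y ⟶ SpecC} {ρ : GmAction f} {L : LineBundle Y}
    (l : Linearization ρ L) (m : ℕ) : Linearization ρ (L.pow m) where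
  h i j _ u x hi hj := l.h i j u x hi hj ^ m
  natural i j _ _ p u x hi hj hi' hj' := by
    rw [map_pow, l.natural i j p u x hi hj hi' hj']
  left i i' j _ u x hi hi' hj := by
    refine (congrArg (· ^ m) (l.left i i' j u x hi hi' hj)).trans ?_
    exact (mul_pow _ _ _).trans (congrArg (_ * ·) (map_pow (pull x _) _ m).symm)
  right i j j' _ u x hi hj hj' := by
    refine (congrArg (· ^ m) (l.right i j j' u x hi hj hj')).trans ?_
    exact (mul_pow _ _ _).trans (congrArg (· * _) (map_pow (pull (ρ.act u x) _) _ m).symm)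
  mul i j k _ v u x hi hj hk hk' := by
    rw [l.mul i j k v u x hi hj hk hk', mul_pow]

/-- The space of the sections `s` of weight `w`, those with `u · s = u ^ w • s` for all `u` in
`ℂ^*`, where `(u · s)(u x) = u · (s x)`. -/
def weightSpace {Y : Scheme.{0}} {f : Y ⟶ SpecC} {ρ : GmAction f} {L : LineBundle Y}
    (l : Linearization ρ L) (w : ℤ) : Submodule ℂ (H0 f L) where
  carrier := {s | ∀ (i j : L.ι) (T : Scheme.{0}) (u : Γ(T, ⊤)ˣ) (x : T ⟶ Y)
    (hi : ⊤ ≤ x ⁻¹ᵁ L.U i) (hj : ⊤ ≤ ρ.act u x ⁻¹ᵁ L.U j),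
    (l.h i j u x hi hj : Γ(T, ⊤)) * pull x hi (s.1 i : Γ(Y, L.U i)) =
      ((u ^ w : Γ(T, ⊤)ˣ) : Γ(T, ⊤)) * pull (ρ.act u x) hj (s.1 j : Γ(Y, L.U j))}
  zero_mem' i j T u x hi hj :=
    ((congrArg _ (map_zero (pull x hi))).trans (mul_zero _)).trans
      ((congrArg _ (map_zero (pull (ρ.act u x) hj))).trans (mul_zero _)).symm
  add_mem' {s t} hs ht i j T u x hi hj := by
    refine (congrArg _ (map_add (pull x hi) (s.1 i : Γ(Y, L.U i)) (t.1 i))).trans ?_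
    refine (mul_add _ _ _).trans ((congrArg₂ (· + ·) (hs i j T u x hi hj)
      (ht i j T u x hi hj)).trans ((mul_add _ _ _).symm.trans (congrArg _ ?_)))
    exact (map_add (pull (ρ.act u x) hj) (s.1 j : Γ(Y, L.U j)) (t.1 j)).symm
  smul_mem' c s hs i j T u x hi hj := by
    refine (congrArg _ (map_mul (pull x hi) (const f (L.U i) c) (s.1 i : Γ(Y, L.U i)))).trans ?_
    refine (mul_left_comm _ _ _).trans ((congrArg₂ (· * ·) (pull_const x f hi c)
      (hs i j T u x hi hj)).trans ((mul_left_comm _ _ _).trans (congrArg _ ?_)))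
    refine ((map_mul (pull (ρ.act u x) hj) (const f (L.U j) c) (s.1 j : Γ(Y, L.U j))).trans
      (congrArg₂ (· * ·) ?_ rfl)).symm
    rw [pull_const, ρ.act_over]

/-- The dimension of `H⁰(Y, L)`. -/
def h0 {Y : Scheme.{0}} (f : Y ⟶ SpecC) (L : LineBundle Y) : ℕ := Module.finrank ℂ (H0 f L)

/-- The total weight of the action of `ℂ^*` on `H⁰(Y, L)`, the sum of the weights counted with
multiplicity. -/
def totalWeight {Y : Scheme.{0}} {f : Y ⟶ SpecC} {ρ : GmAction f} {L : LineBundle Y}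
    (l : Linearization ρ L) : ℤ :=
  ∑ᶠ w : ℤ, w * (Module.finrank ℂ (weightSpace l w) : ℤ)

/-! ## Families over the affine line -/

/-- The affine line `ℂ`. -/
abbrev A1 : Scheme.{0} := Spec (CommRingCat.of (Polynomial ℂ))

/-- The structure morphism of the affine line. -/
def A1.str : A1 ⟶ SpecC := Spec.map (CommRingCat.ofHom Polynomial.C)

/-- The point `a` of the affine line. -/
def A1.pt (a : ℂ) : SpecC ⟶ A1 := Spec.map (CommRingCat.ofHom (Polynomial.evalRingHom a))

/-- The coordinate of a `T`-valued point of the affine line. -/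
def coord {T : Scheme.{0}} (x : T ⟶ A1) : Γ(T, ⊤) :=
  x.appTop.hom ((Scheme.ΓSpecIso (CommRingCat.of (Polynomial ℂ))).inv.hom Polynomial.X)

theorem A1.pt_str (a : ℂ) : A1.pt a ≫ A1.str = 𝟙 SpecC := by
  rw [A1.pt, A1.str, ← Spec.map_comp, ← CommRingCat.ofHom_comp,
    show (Polynomial.evalRingHom a).comp Polynomial.C = RingHom.id ℂ from by ext; simp]
  exact Spec.map_id _

theorem coord_comp {T' T : Scheme.{0}} (p : T' ⟶ T) (x : T ⟶ A1) :
    coord (p ≫ x) = p.appTop.hom (coord x) := by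
  rw [coord, Scheme.Hom.comp_appTop]; rfl

theorem coord_pt (a : ℂ) :
    coord (A1.pt a) = (Scheme.ΓSpecIso (CommRingCat.of ℂ)).inv.hom a := by
  have := Scheme.ΓSpecIso_inv_naturality (CommRingCat.ofHom (Polynomial.evalRingHom a))
  have h := congr($(this).hom Polynomial.X)
  refine h.symm.trans (congrArg (Scheme.ΓSpecIso (CommRingCat.of ℂ)).inv.hom ?_)
  exact Polynomial.eval_X

theorem A1.hom_ext {T : Scheme.{0}} {x y : T ⟶ A1} (h : x ≫ A1.str = y ≫ A1.str)
    (h' : coord x = coord y) : x = y := by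
  apply ext_of_isAffine
  rw [← cancel_epi (Scheme.ΓSpecIso (CommRingCat.of (Polynomial ℂ))).inv]
  apply CommRingCat.hom_ext
  refine Polynomial.ringHom_ext (fun c => ?_) h'
  have key (z : T ⟶ A1) :
      ((Scheme.ΓSpecIso (CommRingCat.of (Polynomial ℂ))).inv ≫ z.appTop).hom (Polynomial.C c) =
      (z ≫ A1.str).appTop.hom ((Scheme.ΓSpecIso (CommRingCat.of ℂ)).inv.hom c) := by
    have := Scheme.ΓSpecIso_inv_naturality (CommRingCat.ofHom (Polynomial.C (R := ℂ)))
    rw [Scheme.Hom.comp_appTop]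
    exact congrArg z.appTop.hom congr($(this).hom c)
  rw [key, key, h]

section Fiber

variable {Y : Scheme.{0}} (p : Y ⟶ A1)

/-- The scheme-theoretic fibre of `p` over the point `a`. -/
def fiber (a : ℂ) : Scheme.{0} := Limits.pullback p (A1.pt a)

/-- The inclusion of the fibre. -/
def fiberIncl (a : ℂ) : fiber p a ⟶ Y := Limits.pullback.fst p (A1.pt a)

/-- The structure morphism of the fibre as a complex scheme. -/
def fiberStr (a : ℂ) : fiber p a ⟶ SpecC := Limits.pullback.snd p (A1.pt a)

theorem fiber_condition (a : ℂ) : fiberIncl p a ≫ p = fiberStr p a ≫ A1.pt a :=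
  Limits.pullback.condition

variable {p}

/-- `p` is equivariant, where `ℂ^*` acts on the affine line by multiplication. -/
def Equivariant (ρ : GmAction (p ≫ A1.str)) : Prop :=
  ∀ {T : Scheme.{0}} (u : Γ(T, ⊤)ˣ) (x : T ⟶ Y), coord (ρ.act u x ≫ p) = u * coord (x ≫ p)

theorem Equivariant.act_zero {ρ : GmAction (p ≫ A1.str)} (hρ : Equivariant ρ) {T : Scheme.{0}}
    (u : Γ(T, ⊤)ˣ) (y : T ⟶ fiber p 0) :
    ρ.act u (y ≫ fiberIncl p 0) ≫ p = (y ≫ fiberStr p 0) ≫ A1.pt 0 := by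
  apply A1.hom_ext
  · rw [Category.assoc, ρ.act_over, Category.assoc, Category.assoc, ← Category.assoc (fiberIncl p 0),
      fiber_condition]
    simp only [Category.assoc]
  · have h0 : coord ((y ≫ fiberStr p 0) ≫ A1.pt 0) = 0 := by
      rw [coord_comp, coord_pt, map_zero, map_zero]
    rw [hρ, Category.assoc, fiber_condition, ← Category.assoc, h0, mul_zero]

/-- The induced action on the central fibre. -/
def GmAction.onCentralFiber {ρ : GmAction (p ≫ A1.str)} (hρ : Equivariant ρ) :
    GmAction (fiberStr p 0) where
  act u y := Limits.pullback.lift (ρ.act u (y ≫ fiberIncl p 0)) (y ≫ fiberStr p 0)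
    (hρ.act_zero u y)
  act_over u y := Limits.pullback.lift_snd _ _ _
  natural q u y := by
    apply Limits.pullback.hom_ext
    · rw [Limits.pullback.lift_fst, Category.assoc, ← ρ.natural]
      exact (Category.assoc _ _ _).trans (congrArg _ (Limits.pullback.lift_fst _ _ _))
    · rw [Limits.pullback.lift_snd]
      refine (Category.assoc _ _ _).trans
        ((congrArg _ (Limits.pullback.lift_snd _ _ _)).trans (Category.assoc _ _ _).symm)
  one_act y := by
    apply Limits.pullback.hom_ext
    · rw [Limits.pullback.lift_fst, ρ.one_act]; rfl
    · rw [Limits.pullback.lift_snd]; rfl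
  mul_act v u y := by
    apply Limits.pullback.hom_ext
    · rw [Limits.pullback.lift_fst, Limits.pullback.lift_fst, ρ.mul_act]
      exact congrArg _ (Limits.pullback.lift_fst _ _ _).symm
    · rw [Limits.pullback.lift_snd, Limits.pullback.lift_snd]
      exact (Limits.pullback.lift_snd _ _ _).symm

theorem GmAction.onCentralFiber_incl {ρ : GmAction (p ≫ A1.str)} (hρ : Equivariant ρ)
    {T : Scheme.{0}} (u : Γ(T, ⊤)ˣ) (y : T ⟶ fiber p 0) :
    (GmAction.onCentralFiber hρ).act u y ≫ fiberIncl p 0 = ρ.act u (y ≫ fiberIncl p 0) :=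
  Limits.pullback.lift_fst _ _ _

theorem GmAction.le_of_onCentralFiber {ρ : GmAction (p ≫ A1.str)} (hρ : Equivariant ρ)
    {T : Scheme.{0}} {u : Γ(T, ⊤)ˣ} {y : T ⟶ fiber p 0} {U : Y.Opens}
    (h : ⊤ ≤ (GmAction.onCentralFiber hρ).act u y ⁻¹ᵁ fiberIncl p 0 ⁻¹ᵁ U) :
    ⊤ ≤ ρ.act u (y ≫ fiberIncl p 0) ⁻¹ᵁ U := by
  rw [← GmAction.onCentralFiber_incl hρ]
  exact h

theorem pull_congr {T X : Scheme.{0}} {x y : T ⟶ X} (e : x = y) {V : X.Opens} {W : T.Opens}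
    (hx : W ≤ x ⁻¹ᵁ V) (hy : W ≤ y ⁻¹ᵁ V) (s : Γ(X, V)) : pull x hx s = pull y hy s := by
  subst e; rfl

/-- The induced linearization of the restriction of the line bundle to the central fibre. -/
def Linearization.onCentralFiber {ρ : GmAction (p ≫ A1.str)} (hρ : Equivariant ρ)
    {L : LineBundle Y} (l : Linearization ρ L) :
    Linearization (GmAction.onCentralFiber hρ) (L.pullback (fiberIncl p 0)) where
  h i j _ u y hi hj := l.h i j u (y ≫ fiberIncl p 0) (le_preimage_comp hi)
    (GmAction.le_of_onCentralFiber hρ hj)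
  natural i j _ _ q u y hi hj hi' hj' := by
    have h1 := GmAction.le_of_onCentralFiber hρ hj'
    rw [Category.assoc] at h1
    exact l.natural i j q u (y ≫ fiberIncl p 0) hi (GmAction.le_of_onCentralFiber hρ hj) hi' h1
  left i i' j _ u y hi hi' hj := by
    refine (l.left i i' j u (y ≫ fiberIncl p 0) hi hi'
      (GmAction.le_of_onCentralFiber hρ hj)).trans (congrArg _ ?_)
    exact (pull_pull y (fiberIncl p 0) _ _ _).symm
  right i j j' _ u y hi hj hj' := by
    refine (l.right i j j' u (y ≫ fiberIncl p 0) hi (GmAction.le_of_onCentralFiber hρ hj)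
      (GmAction.le_of_onCentralFiber hρ hj')).trans (congrArg (· * _) ?_)
    refine .trans ?_ (pull_pull _ (fiberIncl p 0) _ _ _).symm
    exact pull_congr (GmAction.onCentralFiber_incl hρ u y).symm _ _ _
  mul i j k _ v u y hi hj hk hk' := by
    have e := GmAction.onCentralFiber_incl hρ u y
    have h1 := GmAction.le_of_onCentralFiber hρ hk
    have h2 := GmAction.le_of_onCentralFiber hρ hj
    have hj3 : ⊤ ≤ ((GmAction.onCentralFiber hρ).act u y ≫ fiberIncl p 0) ⁻¹ᵁ L.U j := hj
    change _ = l.h j k v ((GmAction.onCentralFiber hρ).act u y ≫ fiberIncl p 0) hj3 h1 * _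
    revert h1 hj3
    rw [e]
    intro h1 hj3
    exact l.mul i j k v u (y ≫ fiberIncl p 0) hi h2 h1 (GmAction.le_of_onCentralFiber hρ hk')

end Fiber

/-! ## Test configurations -/

/-- A test configuration of exponent `k` for the polarized manifold `(X, L)`. -/
structure TestConfiguration {X : Scheme.{0}} (f : X ⟶ SpecC) (L : LineBundle X) (k : ℕ) where
  /-- the total space -/
  total : Scheme.{0}
  /-- the projection to the affine line -/
  proj : total ⟶ A1
  flat : Flat proj
  proper : IsProper proj
  action : GmAction (proj ≫ A1.str)
  equivariant : Equivariant action
  bundle : LineBundle total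
  linearization : Linearization action bundle
  veryAmple : VeryAmple proj bundle
  /-- the isomorphism of the fibre over `1` with `X` -/
  fiberIso : fiber proj 1 ≅ X
  fiberIso_over : fiberIso.hom ≫ f = fiberStr proj 1
  /-- the isomorphism of the line bundle on the fibre over `1` with `L^{⊗ k}` -/
  bundleIso : LineBundle.Iso (bundle.pullback (fiberIncl proj 1))
    ((L.pow k).pullback fiberIso.hom)

/-- The polynomial `P` of degree at most `d` with `F m = P (k m)` for all large `m`; it is unique
if `0 < k`.  The value is `0` if there is none. -/
def expansion (d k : ℕ) (F : ℕ → ℚ) : Polynomial ℚ :=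
  open Classical in
  if h : ∃ P : Polynomial ℚ, P.natDegree ≤ d ∧ ∀ᶠ m in Filter.atTop, F m = P.eval ((k * m : ℕ) : ℚ)
  then h.choose else 0

namespace TestConfiguration

variable {X : Scheme.{0}} {f : X ⟶ SpecC} {L : LineBundle X} {k : ℕ}

/-- A product configuration: the total space is `X × ℂ` (over `ℂ`). -/
def IsProduct (𝒯 : TestConfiguration f L k) : Prop :=
  ∃ φ : 𝒯.total ≅ Limits.pullback f A1.str, φ.hom ≫ Limits.pullback.snd f A1.str = 𝒯.proj

/-- A trivial configuration: the total space is `X × ℂ` and `ℂ^*` acts on the second factor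
only. -/
def IsTrivial (𝒯 : TestConfiguration f L k) : Prop :=
  ∃ φ : 𝒯.total ≅ Limits.pullback f A1.str, φ.hom ≫ Limits.pullback.snd f A1.str = 𝒯.proj ∧
    ∀ (T : Scheme.{0}) (u : Γ(T, ⊤)ˣ) (x : T ⟶ 𝒯.total),
      𝒯.action.act u x ≫ φ.hom ≫ Limits.pullback.fst f A1.str =
        x ≫ φ.hom ≫ Limits.pullback.fst f A1.str

/-- `N_{km}`, the dimension of the space of sections of the `m`-th power of the line bundle on the
central fibre. -/
def N (𝒯 : TestConfiguration f L k) (m : ℕ) : ℕ :=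
  h0 (fiberStr 𝒯.proj 0) ((𝒯.bundle.pow m).pullback (fiberIncl 𝒯.proj 0))

/-- `w_{km}`, the total weight of the action on that space. -/
def w (𝒯 : TestConfiguration f L k) (m : ℕ) : ℤ :=
  totalWeight ((𝒯.linearization.pow m).onCentralFiber 𝒯.equivariant)

/-- The polynomial `a₀ r ^ n + a₁ r ^ (n - 1) + ⋯` with value `N_{km}` at `r = km`, for large
`m`. -/
def polyN (n : ℕ) (𝒯 : TestConfiguration f L k) : Polynomial ℚ :=
  expansion n k (fun m => (𝒯.N m : ℚ))

/-- The polynomial `b₀ r ^ (n + 1) + b₁ r ^ n + ⋯` with value `w_{km}` at `r = km`, for large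
`m`. -/
def polyW (n : ℕ) (𝒯 : TestConfiguration f L k) : Polynomial ℚ :=
  expansion (n + 1) k (fun m => (𝒯.w m : ℚ))

def a₀ (n : ℕ) (𝒯 : TestConfiguration f L k) : ℚ := (𝒯.polyN n).coeff n

/-- The coefficient of `r ^ (n - 1)`, which is `0` for `n = 0`. -/
def a₁ (n : ℕ) (𝒯 : TestConfiguration f L k) : ℚ :=
  if n = 0 then 0 else (𝒯.polyN n).coeff (n - 1)

def b₀ (n : ℕ) (𝒯 : TestConfiguration f L k) : ℚ := (𝒯.polyW n).coeff (n + 1)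

def b₁ (n : ℕ) (𝒯 : TestConfiguration f L k) : ℚ := (𝒯.polyW n).coeff n

/-- The Chow weight `b₀ / a₀ - w_k / (k N_k)`; here `n = dim X`. -/
def Chow (n : ℕ) (𝒯 : TestConfiguration f L k) : ℚ :=
  𝒯.b₀ n / 𝒯.a₀ n - (𝒯.w 1 : ℚ) / (k * 𝒯.N 1)

/-- The Donaldson-Futaki invariant `2 (a₁ b₀ - a₀ b₁) / a₀ ^ 2`. -/
def DF (n : ℕ) (𝒯 : TestConfiguration f L k) : ℚ :=
  2 * ((𝒯.a₁ n * 𝒯.b₀ n - 𝒯.a₀ n * 𝒯.b₁ n) / 𝒯.a₀ n ^ 2)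

/-- The quantized Futaki invariant `k N_k (DF + Chow_k)`. -/
def Fut (n : ℕ) (𝒯 : TestConfiguration f L k) : ℚ :=
  k * 𝒯.N 1 * (𝒯.DF n + 𝒯.Chow n)

end TestConfiguration

/-! ## Stability -/

section Stability

variable {X : Scheme.{0}} (f : X ⟶ SpecC) (n : ℕ) (L : LineBundle X)

def ChowSemistableAt (k : ℕ) : Prop :=
  ∀ 𝒯 : TestConfiguration f L k, 0 ≤ 𝒯.Chow n

def ChowPolystableAt (k : ℕ) : Prop :=
  ChowSemistableAt f n L k ∧ ∀ 𝒯 : TestConfiguration f L k, 𝒯.Chow n = 0 ↔ 𝒯.IsProduct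

def ChowStableAt (k : ℕ) : Prop :=
  ChowSemistableAt f n L k ∧ ∀ 𝒯 : TestConfiguration f L k, 𝒯.Chow n = 0 ↔ 𝒯.IsTrivial

def FSemistableAt (k : ℕ) : Prop :=
  ∀ 𝒯 : TestConfiguration f L k, 0 ≤ 𝒯.Fut n

def FPolystableAt (k : ℕ) : Prop :=
  FSemistableAt f n L k ∧ ∀ 𝒯 : TestConfiguration f L k, 𝒯.Fut n = 0 ↔ 𝒯.IsProduct

def FStableAt (k : ℕ) : Prop :=
  FSemistableAt f n L k ∧ ∀ 𝒯 : TestConfiguration f L k, 𝒯.Fut n = 0 ↔ 𝒯.IsTrivial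

end Stability

/-- The asymptotic version of a property that depends on the level. -/
def Asymptotically (P : ℕ → Prop) : Prop := ∃ k₀ : ℕ, 0 < k₀ ∧ ∀ k, k₀ ≤ k → P k

end

end FanoStability

/-! Replacing the line bundle of a test configuration of exponent `k` by its `m`-th power gives one
of exponent `km` with the same total space and action, hence the same class (product or trivial) and
the same polynomials `N(r)` and `w(r)`. At level `r = km` its Chow weight satisfies `r · Chow_r =
(b₀ r N(r) - a₀ w(r)) / (a₀ N(r))`. The terms of degree `n + 1` in the numerator cancel, and the
next coefficient is `a₁ b₀ - a₀ b₁`, so `r · Chow_r` tends to `DF / 2` (`tendsto_Chow_pow`).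

Chow semistability at all large levels therefore gives `DF ≥ 0`, and `Fut_k = k N_k (DF + Chow_k)`
is nonnegative. If `Fut_k = 0` and `N_k > 0`, then both nonnegative summands vanish; `Chow_k = 0`
makes the configuration product or trivial. Conversely, for such a configuration all powers of high
level have Chow weight zero, so `DF = 0` and `Fut_k = 0` (`fut_eq_zero_iff`).

The geometric work goes into two inputs. A power of a very ample bundle is very ample, by the
Veronese embedding (`VeryAmple.pow`), so that powers are again test configurations. And `N_k > 0`
(`N_pos`): flatness and properness make the central fibre non-empty, homogeneous coordinates provide
a nonzero section, and the space of sections is finite-dimensional, without which its `finrank`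
would be `0`. Finiteness is proved algebraically. A section of `𝒪(d)` on the subscheme cut out by a
homogeneous ideal `I` is treated as a graded map of degree `d` on the coordinate ring in large
degrees, and `finiteModulo_gradedMaps` bounds these by Noetherian induction on `I`, down to the
integral case, where endomorphisms of degree `0` are scalars by an eigenvalue argument.

The existence of the expansions is never proved: if one is missing its value is the zero polynomial,
and then `DF = 0` anyway. -/

namespace FanoStability
noncomputable section

/-! ## Subspaces that are finite-dimensional modulo another subspace -/

section FiniteModulo

variable {K V V' : Type*} [Field K] [AddCommGroup V] [Module K V] [AddCommGroup V'] [Module K V']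

/-- The subspace `A` is finite-dimensional modulo `B`. -/
def FiniteModulo (A B : Submodule K V) : Prop := ∃ W : Submodule K V, W.FG ∧ A ≤ W ⊔ B

/-- Finitely many generators of the image are lifted to `A`, and the lifts span `W`. The inclusion
`W ≤ A` matters in `FiniteModulo.trans`, where the remainder of an element of `A` must stay in `A`.
-/
theorem exists_fg_le_sup_ker (f : V →ₗ[K] V') {A : Submodule K V} (h : (A.map f).FG) :
    ∃ W ≤ A, W.FG ∧ A ≤ W ⊔ LinearMap.ker f := by
  classical
  obtain ⟨s, hs⟩ := h
  have hs' : ∀ x ∈ s, ∃ a ∈ A, f a = x := fun x hx =>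
    (hs ▸ Submodule.subset_span hx : x ∈ A.map f)
  choose! g hg hfg using hs'
  refine ⟨Submodule.span K (s.image g), ?_, ⟨s.image g, rfl⟩, fun a ha => ?_⟩
  · rw [Submodule.span_le]
    intro x hx
    obtain ⟨y, hy, rfl⟩ := Finset.mem_image.mp hx
    exact hg y hy
  · have hle : A.map f ≤ (Submodule.span K (s.image g : Set V)).map f := by
      rw [← hs, Submodule.span_le]
      intro x hx
      exact ⟨g x, Submodule.subset_span (Finset.mem_image_of_mem g hx), hfg x hx⟩
    obtain ⟨w, hw, hwa⟩ := hle ⟨a, ha, rfl⟩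
    rw [← add_sub_cancel w a]
    exact Submodule.add_mem_sup hw (by rw [LinearMap.mem_ker, map_sub, hwa, sub_self])

theorem FiniteModulo.mono {A A' B B' : Submodule K V} (h : FiniteModulo A B) (hA : A' ≤ A)
    (hB : B ≤ B') : FiniteModulo A' B' := by
  obtain ⟨W, hW, hAW⟩ := h
  exact ⟨W, hW, hA.trans (hAW.trans (sup_le_sup_left hB W))⟩

theorem FiniteModulo.of_le {A B : Submodule K V} (h : A ≤ B) : FiniteModulo A B :=
  ⟨⊥, Submodule.fg_bot, h.trans le_sup_right⟩

theorem finiteModulo_iff {A B : Submodule K V} : FiniteModulo A B ↔ (A.map B.mkQ).FG := by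
  constructor
  · rintro ⟨W, hW, h⟩
    have : FiniteDimensional K (W.map B.mkQ) := Module.Finite.iff_fg.mpr (hW.map _)
    have hle : A.map B.mkQ ≤ W.map B.mkQ := by
      refine (Submodule.map_mono h).trans ?_
      rw [Submodule.map_sup, sup_le_iff]
      refine ⟨le_rfl, ?_⟩
      rintro _ ⟨b, hb, rfl⟩
      rw [(Submodule.Quotient.mk_eq_zero B).mpr hb |> fun h => (h : B.mkQ b = 0)]
      exact zero_mem _
    exact Module.Finite.iff_fg.mp (Submodule.finiteDimensional_of_le hle)
  · intro h
    obtain ⟨W, -, hW, hA⟩ := exists_fg_le_sup_ker B.mkQ h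
    exact ⟨W, hW, by rwa [Submodule.ker_mkQ] at hA⟩

/-- The composite of `A → V'` with the quotient by `B'` has finite-dimensional image, and its kernel
is the preimage of `B'`. -/
theorem FiniteModulo.comap (T : V →ₗ[K] V') {A : Submodule K V} {A' B' : Submodule K V'}
    (h : FiniteModulo A' B') (hA : A.map T ≤ A') : FiniteModulo A (B'.comap T) := by
  have h1 := finiteModulo_iff.mp (h.mono hA le_rfl)
  rw [← Submodule.map_comp] at h1
  obtain ⟨W, -, hW, hAW⟩ := exists_fg_le_sup_ker _ h1
  refine ⟨W, hW, ?_⟩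
  rwa [LinearMap.ker_comp, Submodule.ker_mkQ] at hAW

theorem FiniteModulo.trans {A B C : Submodule K V} (h : FiniteModulo A B)
    (h' : FiniteModulo (A ⊓ B) C) : FiniteModulo A C := by
  obtain ⟨W, hWA, hW, hA⟩ := exists_fg_le_sup_ker B.mkQ (finiteModulo_iff.mp h)
  rw [Submodule.ker_mkQ] at hA
  obtain ⟨W', hW', hAB⟩ := h'
  refine ⟨W ⊔ W', hW.sup hW', fun a ha => ?_⟩
  obtain ⟨w, hw, b, hb, rfl⟩ := Submodule.mem_sup.mp (hA ha)
  have hbA : b ∈ A := by simpa using A.sub_mem ha (hWA hw)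
  rw [sup_assoc]
  exact Submodule.add_mem_sup hw (hAB ⟨hbA, hb⟩)

end FiniteModulo

/-! ## Sections of twists of the structure sheaf of a projective scheme, algebraically -/

section GradedMaps

open MvPolynomial

variable {K σ : Type*} [Field K]

/-- The ideal `I` is homogeneous. -/
def HomogeneousClosed (I : Ideal (MvPolynomial σ K)) : Prop :=
  ∀ F ∈ I, ∀ n, homogeneousComponent n F ∈ I

/-- The sections of `𝒪(d)` on the closed subscheme of projective space defined by the homogeneous
ideal `I`, as the graded linear maps of degree `d`, defined in all large degrees, to the homogeneous
coordinate ring; they are represented by maps to the polynomial ring. -/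
def gradedMaps (I : Ideal (MvPolynomial σ K)) (d : ℤ) :
    Submodule K (ℕ → MvPolynomial σ K → MvPolynomial σ K) where
  carrier := {φ | ∃ n₀, ∀ n ≥ n₀, ∀ F : MvPolynomial σ K, F.IsHomogeneous n →
    (∃ m : ℕ, (m : ℤ) = n + d ∧ (φ n F).IsHomogeneous m) ∧
    (∀ G, G.IsHomogeneous n → φ n (F + G) - (φ n F + φ n G) ∈ I) ∧
    (∀ k (G : MvPolynomial σ K), G.IsHomogeneous k → φ (k + n) (G * F) - G * φ n F ∈ I)}
  zero_mem' := by
    -- For `n ≥ |d|` the target degree `n + d` is a natural number.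
    refine ⟨d.natAbs, fun n hn F _ => ⟨⟨(n + d).toNat, by lia, isHomogeneous_zero _ _ _⟩, ?_, ?_⟩⟩
      <;> simp
  add_mem' := by
    rintro φ ψ ⟨n₁, h₁⟩ ⟨n₂, h₂⟩
    refine ⟨max n₁ n₂, fun n hn F hF => ?_⟩
    obtain ⟨⟨m, hm, hφ⟩, hφ', hφ''⟩ := h₁ n (le_of_max_le_left hn) F hF
    obtain ⟨⟨m', hm', hψ⟩, hψ', hψ''⟩ := h₂ n (le_of_max_le_right hn) F hF
    obtain rfl : m = m' := by lia
    refine ⟨⟨m, hm, hφ.add hψ⟩, fun G hG => ?_, fun k G hG => ?_⟩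
    · convert I.add_mem (hφ' G hG) (hψ' G hG) using 1
      simp only [Pi.add_apply]; ring
    · convert I.add_mem (hφ'' k G hG) (hψ'' k G hG) using 1
      simp only [Pi.add_apply]; ring
  smul_mem' := by
    rintro c φ ⟨n₁, h₁⟩
    refine ⟨n₁, fun n hn F hF => ?_⟩
    obtain ⟨⟨m, hm, hφ⟩, hφ', hφ''⟩ := h₁ n hn F hF
    refine ⟨⟨m, hm, ?_⟩, fun G hG => ?_, fun k G hG => ?_⟩
    · rw [Pi.smul_apply, Pi.smul_apply, smul_eq_C_mul]; exact hφ.C_mul c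
    · convert I.mul_mem_left (C c) (hφ' G hG) using 1
      simp only [Pi.smul_apply, smul_eq_C_mul]; ring
    · convert I.mul_mem_left (C c) (hφ'' k G hG) using 1
      simp only [Pi.smul_apply, smul_eq_C_mul]; ring

/-- The maps that represent the zero section. -/
def nullMaps (I : Ideal (MvPolynomial σ K)) :
    Submodule K (ℕ → MvPolynomial σ K → MvPolynomial σ K) where
  carrier := {φ | ∃ n₀, ∀ n ≥ n₀, ∀ F : MvPolynomial σ K, F.IsHomogeneous n → φ n F ∈ I}
  zero_mem' := ⟨0, fun _ _ _ _ => I.zero_mem⟩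
  add_mem' := by
    rintro φ ψ ⟨n₁, h₁⟩ ⟨n₂, h₂⟩
    exact ⟨max n₁ n₂, fun n hn F hF => I.add_mem (h₁ n (le_of_max_le_left hn) F hF)
      (h₂ n (le_of_max_le_right hn) F hF)⟩
  smul_mem' := by
    rintro c φ ⟨n₁, h₁⟩
    refine ⟨n₁, fun n hn F hF => ?_⟩
    rw [Pi.smul_apply, Pi.smul_apply, smul_eq_C_mul]
    exact I.mul_mem_left _ (h₁ n hn F hF)

theorem gradedMaps_mono {I J : Ideal (MvPolynomial σ K)} (h : I ≤ J) (d : ℤ) :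
    gradedMaps I d ≤ gradedMaps J d := by
  rintro φ ⟨n₀, h₀⟩
  refine ⟨n₀, fun n hn F hF => ⟨(h₀ n hn F hF).1, fun G hG => h ((h₀ n hn F hF).2.1 G hG),
    fun k G hG => h ((h₀ n hn F hF).2.2 k G hG)⟩⟩

/-- The ideal quotient `I : a`. -/
def colonBy (I : Ideal (MvPolynomial σ K)) (a : MvPolynomial σ K) : Ideal (MvPolynomial σ K) :=
  Submodule.comap (LinearMap.mulLeft (MvPolynomial σ K) a) I

theorem mem_colonBy {I : Ideal (MvPolynomial σ K)} {a g : MvPolynomial σ K} :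
    g ∈ colonBy I a ↔ a * g ∈ I := Iff.rfl

theorem homogeneousComponent_mul_of_isHomogeneous {a : MvPolynomial σ K} {e : ℕ}
    (ha : a.IsHomogeneous e) (g : MvPolynomial σ K) (m : ℕ) :
    homogeneousComponent m (a * g) = if e ≤ m then a * homogeneousComponent (m - e) g else 0 := by
  conv_lhs => rw [← sum_homogeneousComponent g, Finset.mul_sum, map_sum]
  have h (i : ℕ) : homogeneousComponent m (a * homogeneousComponent i g) =
      if m = e + i then a * homogeneousComponent i g else 0 :=
    homogeneousComponent_of_mem (ha.mul (homogeneousComponent_isHomogeneous i g))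
  simp_rw [h]
  split_ifs with hm
  · obtain ⟨k, rfl⟩ := Nat.exists_eq_add_of_le hm
    simp only [Nat.add_right_inj, Finset.sum_ite_eq, Nat.add_sub_cancel_left]
    split_ifs with hk
    · rfl
    · rw [homogeneousComponent_eq_zero _ _ (by simpa using hk), mul_zero]
  · exact Finset.sum_eq_zero fun i _ => if_neg (by lia)

theorem HomogeneousClosed.colonBy {I : Ideal (MvPolynomial σ K)} (hI : HomogeneousClosed I)
    {a : MvPolynomial σ K} {e : ℕ} (ha : a.IsHomogeneous e) : HomogeneousClosed (colonBy I a) := by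
  intro g hg n
  have := hI _ hg (e + n)
  rw [LinearMap.mulLeft_apply, homogeneousComponent_mul_of_isHomogeneous ha, if_pos (by lia),
    Nat.add_sub_cancel_left] at this
  exact this

theorem HomogeneousClosed.sup_span {I : Ideal (MvPolynomial σ K)} (hI : HomogeneousClosed I)
    {a : MvPolynomial σ K} {e : ℕ} (ha : a.IsHomogeneous e) :
    HomogeneousClosed (I ⊔ Ideal.span {a}) := by
  intro g hg n
  obtain ⟨i, hi, _, hb, rfl⟩ := Submodule.mem_sup.mp hg
  obtain ⟨b, rfl⟩ := Ideal.mem_span_singleton.mp hb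
  rw [map_add, homogeneousComponent_mul_of_isHomogeneous ha]
  refine Submodule.add_mem_sup (hI _ hi n) ?_
  split_ifs
  · exact Ideal.mem_span_singleton.mpr (dvd_mul_right _ _)
  · exact zero_mem _

/-- Multiplication of sections by the form `a`. -/
def mulMap (a : MvPolynomial σ K) : (ℕ → MvPolynomial σ K → MvPolynomial σ K) →ₗ[K]
    (ℕ → MvPolynomial σ K → MvPolynomial σ K) :=
  LinearMap.mulLeft K (fun _ _ => a)

theorem mulMap_apply (a : MvPolynomial σ K) (φ : ℕ → MvPolynomial σ K → MvPolynomial σ K) (n : ℕ)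
    (F : MvPolynomial σ K) : mulMap a φ n F = a * φ n F := rfl

theorem mulMap_mem_nullMaps {I : Ideal (MvPolynomial σ K)} {a : MvPolynomial σ K}
    {φ : ℕ → MvPolynomial σ K → MvPolynomial σ K} :
    mulMap a φ ∈ nullMaps I ↔ φ ∈ nullMaps (colonBy I a) := Iff.rfl

theorem mulMap_mem_gradedMaps {I : Ideal (MvPolynomial σ K)} {a : MvPolynomial σ K} {e : ℕ}
    (ha : a.IsHomogeneous e) {d : ℤ} {φ : ℕ → MvPolynomial σ K → MvPolynomial σ K}
    (h : φ ∈ gradedMaps I d) : mulMap a φ ∈ gradedMaps I (d + e) := by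
  obtain ⟨n₁, h₁⟩ := h
  refine ⟨n₁, fun n hn F hF => ?_⟩
  obtain ⟨⟨m, hm, hφ⟩, hφ', hφ''⟩ := h₁ n hn F hF
  refine ⟨⟨e + m, by push_cast; lia, ha.mul hφ⟩, fun G hG => ?_, fun k G hG => ?_⟩
  · convert I.mul_mem_left a (hφ' G hG) using 1
    simp only [mulMap_apply]; ring
  · convert I.mul_mem_left a (hφ'' k G hG) using 1
    simp only [mulMap_apply]; ring

/-- A section that vanishes on the hypersurface `a = 0` is divisible by `a`. -/
theorem gradedMaps_inf_nullMaps_le {I : Ideal (MvPolynomial σ K)} (hI : HomogeneousClosed I)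
    {a : MvPolynomial σ K} {e : ℕ} (ha : a.IsHomogeneous e) (d : ℤ) :
    gradedMaps I d ⊓ nullMaps (I ⊔ Ideal.span {a}) ≤
      (gradedMaps (colonBy I a) (d - e)).map (mulMap a) ⊔ nullMaps I := by
  rintro φ ⟨⟨n₁, h₁⟩, ⟨n₂, h₂⟩⟩
  -- The last bound makes the target degree `m = n + d` at least `e`, so that a factor of degree `e`
  -- can be split off.
  let n₀ := max (max n₁ n₂) (e + d.natAbs)
  have key (n : ℕ) (F : MvPolynomial σ K) : ∃ G : MvPolynomial σ K, n₀ ≤ n → F.IsHomogeneous n →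
      a * G - φ n F ∈ I ∧ ∃ k : ℕ, (k : ℤ) = n + (d - e) ∧ G.IsHomogeneous k := by
    by_cases hn : n₀ ≤ n ∧ F.IsHomogeneous n
    · have hn1 : n₁ ≤ n := (le_max_left _ _).trans ((le_max_left _ _).trans hn.1)
      have hn2 : n₂ ≤ n := (le_max_right _ _).trans ((le_max_left _ _).trans hn.1)
      have hn3 : e + d.natAbs ≤ n := (le_max_right _ _).trans hn.1
      obtain ⟨⟨m, hm, hφ⟩, -, -⟩ := h₁ n hn1 F hn.2
      obtain ⟨i, hi, _, hb, hib⟩ := Submodule.mem_sup.mp (h₂ n hn2 F hn.2)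
      obtain ⟨b, rfl⟩ := Ideal.mem_span_singleton.mp hb
      -- Since `I` is homogeneous, comparing components of degree `m` replaces the cofactor `b` by a
      -- form of degree `m - e`.
      refine ⟨homogeneousComponent (m - e) b, fun _ _ => ⟨?_, m - e, by lia,
        homogeneousComponent_isHomogeneous _ _⟩⟩
      have h3 := congrArg (homogeneousComponent m) hib
      rw [map_add, homogeneousComponent_mul_of_isHomogeneous ha, if_pos (by lia),
        homogeneousComponent_eq_self hφ] at h3
      rw [← h3]
      simpa using hi |> fun h => hI _ h m
    · exact ⟨0, fun h h' => absurd ⟨h, h'⟩ hn⟩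
  choose ψ hψ using key
  have hnull : φ - mulMap a ψ ∈ nullMaps I := by
    refine ⟨n₀, fun n hn F hF => ?_⟩
    have := I.neg_mem (hψ n F hn hF).1
    rwa [neg_sub] at this
  -- The quotient by `a` is determined only modulo `I : a`; its congruences are checked after
  -- multiplication by `a`.
  have hmem : ψ ∈ gradedMaps (colonBy I a) (d - e) := by
    refine ⟨n₀, fun n hn F hF => ?_⟩
    have hn1 : n₁ ≤ n := (le_max_left _ _).trans ((le_max_left _ _).trans hn)
    obtain ⟨-, h3, h4⟩ := h₁ n hn1 F hF
    refine ⟨(hψ n F hn hF).2, fun G hG => ?_, fun k G hG => ?_⟩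
    · rw [mem_colonBy]
      convert I.sub_mem (I.add_mem (hψ n (F + G) hn (hF.add hG)).1 (h3 G hG))
        (I.add_mem (hψ n F hn hF).1 (hψ n G hn hG).1) using 1
      ring
    · rw [mem_colonBy]
      convert I.sub_mem (I.add_mem (hψ (k + n) (G * F) (by lia) (hG.mul hF)).1 (h4 k G hG))
        (I.mul_mem_left G (hψ n F hn hF).1) using 1
      ring
  have := Submodule.add_mem_sup (Submodule.mem_map_of_mem (f := mulMap a) hmem) hnull
  rwa [add_sub_cancel] at this

/-- This is the exact sequence `0 → (S/(I : a))(-e) → S/I → S/(I + (a)) → 0` on the level of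
sections: restrict to the hypersurface `a = 0`; what restricts to zero is a multiple of `a`. -/
theorem FiniteModulo.of_hypersurface {I : Ideal (MvPolynomial σ K)} (hI : HomogeneousClosed I)
    {a : MvPolynomial σ K} {e : ℕ} (ha : a.IsHomogeneous e) (d : ℤ)
    (h : FiniteModulo (gradedMaps (I ⊔ Ideal.span {a}) d) (nullMaps (I ⊔ Ideal.span {a})))
    (h' : FiniteModulo (gradedMaps (FanoStability.colonBy I a) (d - e))
      (nullMaps (FanoStability.colonBy I a))) :
    FiniteModulo (gradedMaps I d) (nullMaps I) := by
  refine (h.mono (gradedMaps_mono le_sup_left d) le_rfl).trans ?_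
  obtain ⟨W, hW, hle⟩ := h'
  refine ⟨W.map (mulMap a), hW.map _, (gradedMaps_inf_nullMaps_le hI ha d).trans ?_⟩
  refine sup_le ((Submodule.map_mono hle).trans ?_) le_sup_right
  rw [Submodule.map_sup]
  refine sup_le_sup_left ?_ _
  rintro _ ⟨φ, hφ, rfl⟩
  exact mulMap_mem_nullMaps.mpr hφ

/-- If every variable vanishes on the subscheme then there are no nonzero sections. -/
theorem gradedMaps_le_nullMaps [Finite σ] {I : Ideal (MvPolynomial σ K)} (h : ∀ i, X i ∈ I)
    (d : ℤ) : gradedMaps I d ≤ nullMaps I := by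
  rintro φ ⟨n₀, h₀⟩
  -- The extra `1` makes the degree `n + d` positive, so `φ n F` has no constant term.
  refine ⟨n₀ + d.natAbs + 1, fun n hn F hF => ?_⟩
  obtain ⟨⟨m, hm, hφ⟩, -, -⟩ := h₀ n (by lia) F hF
  have hc : constantCoeff (φ n F) = 0 := hφ.coeff_eq_zero (by
    simp only [map_zero]
    lia)
  have hker : φ n F ∈ RingHom.ker (constantCoeff (R := K) (σ := σ)) := hc
  have hle : RingHom.ker (constantCoeff (R := K) (σ := σ)) ≤ I := by
    intro p hp
    rw [← p.support_sum_monomial_coeff]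
    refine I.sum_mem fun s hs => ?_
    have hs0 : s ≠ 0 := by
      rintro rfl
      exact (mem_support_iff.mp hs) hp
    obtain ⟨i, hi⟩ := Finsupp.ne_iff.mp hs0
    refine I.mem_of_dvd ?_ (h i)
    rw [X_dvd_monomial]
    exact Or.inr hi
  exact hle hker

/-- On an integral subscheme the sections of the structure sheaf are the constants. -/
theorem finiteModulo_gradedMaps_zero [IsAlgClosed K] [Finite σ] {I : Ideal (MvPolynomial σ K)}
    (hprime : ∀ (a b : MvPolynomial σ K) (k l : ℕ), a.IsHomogeneous k → b.IsHomogeneous l →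
      a * b ∈ I → a ∈ I ∨ b ∈ I) {i : σ} (hi : X i ∉ I) :
    FiniteModulo (gradedMaps I 0) (nullMaps I) := by
  have hpow (n : ℕ) : (X i : MvPolynomial σ K) ^ n ∉ I := by
    induction n with
    | zero =>
      rw [pow_zero]
      intro h
      exact hi ((I.eq_top_iff_one.mpr h) ▸ trivial)
    | succ n ih =>
      rw [pow_succ]
      intro h
      exact (hprime _ _ _ _ (isHomogeneous_X_pow i n) (isHomogeneous_X K i) h).elim ih hi
  let id' : ℕ → MvPolynomial σ K → MvPolynomial σ K := fun _ F => F
  have hid : id' ∈ gradedMaps I 0 := by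
    refine ⟨0, fun n _ F hF => ⟨⟨n, by simp, hF⟩, fun G _ => ?_, fun k G _ => ?_⟩⟩ <;> simp [id']
  refine ⟨Submodule.span K {id'}, Submodule.fg_span_singleton _, ?_⟩
  intro φ hφ
  have hφ₀ := hφ
  obtain ⟨n₀, h₀⟩ := hφ
  have hdeg (F : homogeneousSubmodule σ K n₀) : (φ n₀ F).IsHomogeneous n₀ := by
    obtain ⟨⟨m, hm, h⟩, -, -⟩ := h₀ n₀ le_rfl F F.2
    obtain rfl : m = n₀ := by lia
    exact h
  -- Both `X i ^ n₀ * φ n₀ F` and `F * φ n₀ (X i ^ n₀)` are congruent to `φ` of the product, and `X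
  -- i ^ n₀` can be cancelled modulo `I`. So `φ` descends to the quotient of the forms of degree
  -- `n₀` by those in `I`.
  have hI (F : homogeneousSubmodule σ K n₀) (hF : (F : MvPolynomial σ K) ∈ I) : φ n₀ F ∈ I := by
    have hX := isHomogeneous_X_pow (R := K) i n₀
    have h1 := (h₀ n₀ le_rfl F F.2).2.2 n₀ _ hX
    have h2 := (h₀ n₀ le_rfl _ hX).2.2 n₀ F F.2
    rw [mul_comm] at h2
    have h3 : X i ^ n₀ * φ n₀ F ∈ I := by
      convert I.add_mem (I.sub_mem h2 h1) (I.mul_mem_right (φ n₀ (X i ^ n₀)) hF) using 1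
      ring
    exact (hprime _ _ _ _ hX (hdeg F) h3).resolve_left (hpow n₀)
  let N : Submodule K (homogeneousSubmodule σ K n₀) :=
    (I.restrictScalars K).comap (homogeneousSubmodule σ K n₀).subtype
  have hmem (F : homogeneousSubmodule σ K n₀) : F ∈ N ↔ (F : MvPolynomial σ K) ∈ I := Iff.rfl
  let g : homogeneousSubmodule σ K n₀ →ₗ[K] (homogeneousSubmodule σ K n₀ ⧸ N) :=
    { toFun := fun F => N.mkQ ⟨φ n₀ F, hdeg F⟩
      map_add' := fun F G => by
        rw [← map_add, ← sub_eq_zero, ← map_sub]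
        exact (Submodule.Quotient.mk_eq_zero N).mpr ((h₀ n₀ le_rfl F F.2).2.1 G G.2)
      map_smul' := fun c F => by
        rw [RingHom.id_apply, ← map_smul, ← sub_eq_zero, ← map_sub]
        refine (Submodule.Quotient.mk_eq_zero N).mpr ?_
        have := (h₀ n₀ le_rfl F F.2).2.2 0 (C c) (isHomogeneous_C σ c)
        rw [zero_add] at this
        rw [hmem]
        simpa [smul_eq_C_mul] using this }
  have hg : N ≤ LinearMap.ker g := fun F hF =>
    (Submodule.Quotient.mk_eq_zero N).mpr (hI F hF)
  have : FiniteDimensional K (homogeneousSubmodule σ K n₀) :=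
    Module.Finite.iff_fg.mpr (homogeneousSubmodule_fg σ K n₀)
  have : Nontrivial (homogeneousSubmodule σ K n₀ ⧸ N) := by
    refine Submodule.Quotient.nontrivial_iff.mpr fun h => ?_
    exact hpow n₀ ((hmem ⟨_, isHomogeneous_X_pow i n₀⟩).mp (h ▸ trivial))
  -- The descended map is an endomorphism of a nonzero finite-dimensional space over an
  -- algebraically closed field. Its eigenvalue `c` is the constant to which the section is equal.
  obtain ⟨c, hc⟩ := Module.End.exists_eigenvalue (N.liftQ g hg)
  obtain ⟨v, hv⟩ := hc.exists_hasEigenvector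
  obtain ⟨F, rfl⟩ := N.mkQ_surjective v
  have hF : (F : MvPolynomial σ K) ∉ I := fun h =>
    hv.2 ((Submodule.Quotient.mk_eq_zero N).mpr h)
  have hFc : φ n₀ F - C c * (F : MvPolynomial σ K) ∈ I := by
    have h1 := hv.apply_eq_smul
    rw [Submodule.mkQ_apply, Submodule.liftQ_apply, ← Submodule.mkQ_apply, ← map_smul,
      ← sub_eq_zero] at h1
    have h2 := (Submodule.Quotient.mk_eq_zero N).mp ((map_sub N.mkQ _ _).trans h1)
    rw [← smul_eq_C_mul]
    exact h2
  -- With the eigenvector `F`, one has `F * φ n G ≡ G * φ n₀ F ≡ c G F` modulo `I`, and `F ∉ I` can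
  -- be cancelled.
  have hψ : φ - c • id' ∈ nullMaps I := by
    obtain ⟨n₁, h₁⟩ := (gradedMaps I 0).sub_mem hφ₀ ((gradedMaps I 0).smul_mem c hid)
    refine ⟨max n₀ n₁, fun n hn G hG => ?_⟩
    have hG1 := (h₀ n₀ le_rfl F F.2).2.2 n G hG
    have hG2 := (h₀ n (le_of_max_le_left hn) G hG).2.2 n₀ F F.2
    obtain ⟨⟨m, -, hm⟩, -, -⟩ := h₁ n (le_of_max_le_right hn) G hG
    refine (hprime _ _ _ _ F.2 hm ?_).resolve_left hF
    rw [mul_comm G, add_comm n] at hG1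
    convert I.add_mem (I.sub_mem hG1 hG2) (I.mul_mem_left G hFc) using 1
    simp only [Pi.sub_apply, Pi.smul_apply, id', smul_eq_C_mul]
    ring
  rw [sup_comm, ← sub_add_cancel φ (c • id')]
  exact Submodule.add_mem_sup hψ (Submodule.smul_mem _ _ (Submodule.mem_span_singleton_self _))

/-- As `X i` is not a zero divisor modulo `I`, multiplication by it embeds the sections of `𝒪(d)`
into those of `𝒪(d + 1)`. -/
theorem FiniteModulo.of_mulMap {I : Ideal (MvPolynomial σ K)} {i : σ}
    (hi : FanoStability.colonBy I (X i) = I) {d : ℤ}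
    (h : FiniteModulo (gradedMaps I (d + 1)) (nullMaps I)) :
    FiniteModulo (gradedMaps I d) (nullMaps I) := by
  refine (h.comap (mulMap (X i)) ?_).mono le_rfl ?_
  · rintro _ ⟨φ, hφ, rfl⟩
    exact mulMap_mem_gradedMaps (isHomogeneous_X K i) hφ
  · intro φ hφ
    have := mulMap_mem_nullMaps.mp hφ
    rwa [hi] at this

/-- The space of sections of `𝒪(d)` on a closed subscheme of projective space is
finite-dimensional. -/
theorem finiteModulo_gradedMaps [IsAlgClosed K] [Finite σ] (I : Ideal (MvPolynomial σ K))
    (hI : HomogeneousClosed I) (d : ℤ) : FiniteModulo (gradedMaps I d) (nullMaps I) := by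
  induction I using WellFoundedGT.induction generalizing d with
  | ind I ih =>
  -- If `I` is not prime with respect to forms, a zero divisor `a` makes both `I + (a)` and `I : a`
  -- strictly larger than `I`, and the induction hypothesis applies to both.
  by_cases hnp : ∃ (a b : MvPolynomial σ K) (k l : ℕ), a.IsHomogeneous k ∧ b.IsHomogeneous l ∧
      a * b ∈ I ∧ a ∉ I ∧ b ∉ I
  · obtain ⟨a, b, k, l, ha, -, hab, haI, hbI⟩ := hnp
    refine .of_hypersurface hI ha d (ih _ ?_ (hI.sup_span ha) d) (ih _ ?_ (hI.colonBy ha) _)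
    · refine lt_of_le_of_ne le_sup_left fun h => haI ?_
      rw [h]
      exact Ideal.mem_sup_right (Ideal.mem_span_singleton_self a)
    · refine lt_of_le_of_ne (fun x hx => I.mul_mem_left a hx) fun h => hbI ?_
      rw [h]
      exact hab
  have hprime : ∀ (a b : MvPolynomial σ K) (k l : ℕ), a.IsHomogeneous k → b.IsHomogeneous l →
      a * b ∈ I → a ∈ I ∨ b ∈ I := by
    intro a b k l ha hb hab
    by_contra! h
    exact hnp ⟨a, b, k, l, ha, hb, hab, h.1, h.2⟩
  by_cases hX : ∀ i, (X i : MvPolynomial σ K) ∈ I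
  · exact .of_le (gradedMaps_le_nullMaps hX d)
  push Not at hX
  obtain ⟨i, hi⟩ := hX
  have hcolon : colonBy I (X i) = I := by
    refine le_antisymm (fun g hg => ?_) (fun g hg => I.mul_mem_left _ hg)
    rw [← sum_homogeneousComponent g]
    refine I.sum_mem fun n _ => ?_
    have h1 := hI.colonBy (isHomogeneous_X K i) g hg n
    exact (hprime _ _ _ _ (isHomogeneous_X K i) (homogeneousComponent_isHomogeneous n g)
      h1).resolve_left hi
  have hlt : I < I ⊔ Ideal.span {X i} := by
    refine lt_of_le_of_ne le_sup_left fun h => hi ?_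
    rw [h]
    exact Ideal.mem_sup_right (Ideal.mem_span_singleton_self _)
  -- In the prime case `I : X i = I`, so the hypersurface `X i = 0` relates degrees `d` and `d - 1`
  -- for the same ideal. The induction starts from the constants at `d = 0`, goes up by the exact
  -- sequence and down by injectivity of multiplication.
  induction d using Int.induction_on with
  | zero => exact finiteModulo_gradedMaps_zero hprime hi
  | succ n hn =>
    refine .of_hypersurface hI (isHomogeneous_X K i) _
      (ih _ hlt (hI.sup_span (isHomogeneous_X K i)) _) ?_
    rw [hcolon]
    simpa using hn
  | pred n hn => exact .of_mulMap hcolon (by simpa using hn)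

end GradedMaps

/-! ## Morphisms to affine open subsets -/

theorem comp_toSpec_of_appLE {T Z : Scheme.{0}} {U : Z.Opens} (hU : IsAffineOpen U) (x : T ⟶ Z)
    (hx : ⊤ ≤ x ⁻¹ᵁ U) :
    (⊤ : T.Opens).toSpecΓ ≫ Spec.map (x.appLE U ⊤ hx) ≫ hU.fromSpec = (⊤ : T.Opens).ι ≫ x := by
  rw [Scheme.Opens.toSpecΓ_SpecMap_appLE_assoc, IsAffineOpen.toSpecΓ_fromSpec,
    Scheme.Hom.resLE_comp_ι]

theorem hom_ext_of_isAffineOpen {T Z : Scheme.{0}} {U : Z.Opens} (hU : IsAffineOpen U)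
    {x y : T ⟶ Z} (hx : ⊤ ≤ x ⁻¹ᵁ U) (hy : ⊤ ≤ y ⁻¹ᵁ U) (h : pull x hx = pull y hy) : x = y := by
  have h' : x.appLE U ⊤ hx = y.appLE U ⊤ hy := CommRingCat.hom_ext h
  rw [← cancel_epi (Scheme.topIso T).hom]
  exact (comp_toSpec_of_appLE hU x hx).symm.trans
    ((congrArg (fun z => (⊤ : T.Opens).toSpecΓ ≫ Spec.map z ≫ hU.fromSpec) h').trans
      (comp_toSpec_of_appLE hU y hy))

/-- The morphism is the composite `T ⟶ Spec Γ(T, ⊤) ⟶ Spec Γ(Z, U) ⟶ Z`; the rest of the proof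
identifies its action on functions. -/
theorem exists_hom_of_isAffineOpen {T Z : Scheme.{0}} {U : Z.Opens} (hU : IsAffineOpen U)
    (γ : Γ(Z, U) →+* Γ(T, ⊤)) : ∃ (x : T ⟶ Z) (hx : ⊤ ≤ x ⁻¹ᵁ U), pull x hx = γ := by
  let g := Spec.map (CommRingCat.ofHom γ)
  have h1 : ⊤ ≤ hU.fromSpec ⁻¹ᵁ U := hU.fromSpec_preimage_self.ge
  refine ⟨T.toSpecΓ ≫ g ≫ hU.fromSpec, fun p _ => h1 trivial, ?_⟩
  ext s
  have h2 : pull hU.fromSpec h1 s = (Scheme.ΓSpecIso Γ(Z, U)).inv.hom s := by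
    have h3 : hU.fromSpec.appLE U ⊤ h1 = (Scheme.ΓSpecIso Γ(Z, U)).inv := by
      rw [Scheme.Hom.appLE, hU.fromSpec_app_self, Category.assoc, ← Functor.map_comp]
      exact (congrArg _ (CategoryTheory.Functor.map_id _ _)).trans (Category.comp_id _)
    exact congr($(h3).hom s)
  have h4 : pull g (V := ⊤) (W := ⊤) le_top ((Scheme.ΓSpecIso Γ(Z, U)).inv.hom s) =
      (Scheme.ΓSpecIso Γ(T, ⊤)).inv.hom (γ s) := by
    have := Scheme.ΓSpecIso_inv_naturality (CommRingCat.ofHom γ)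
    refine .trans ?_ congr($(this).hom s).symm
    refine congr($(Scheme.Hom.appLE_eq_app (f := g) (U := ⊤)).hom _)
  have h5 (t : Γ(T, ⊤)) : pull T.toSpecΓ (V := ⊤) (W := ⊤) le_top
      ((Scheme.ΓSpecIso Γ(T, ⊤)).inv.hom t) = t := by
    refine (congr($(Scheme.Hom.appLE_eq_app (f := T.toSpecΓ) (U := ⊤)).hom _)).trans ?_
    have h6 := Scheme.toSpecΓ_appTop T
    refine (congr($(h6).hom _)).trans ?_
    exact congr($((Scheme.ΓSpecIso Γ(T, ⊤)).inv_hom_id).hom t)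
  have h7 := pull_pull (T.toSpecΓ ≫ g) hU.fromSpec h1 (W := ⊤) le_top s
  rw [h2, ← pull_pull T.toSpecΓ g (V := ⊤) le_top le_top, h4, h5] at h7
  exact h7.symm

/-- The functions on `U` that come from the base. -/
def scalars {R : Type} [CommRing R] {T : Scheme.{0}} (q : T ⟶ Spec (CommRingCat.of R))
    (U : T.Opens) : R →+* Γ(T, U) :=
  (pull q (V := ⊤) le_top).comp (Scheme.ΓSpecIso (CommRingCat.of R)).inv.hom

/-! ### Pull-back of scalars from an affine base -/

section Scalars

variable {R : Type} [CommRing R]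

theorem pull_scalars {T Z : Scheme.{0}} (x : T ⟶ Z) (q : Z ⟶ Spec (CommRingCat.of R)) {V : Z.Opens}
    {W : T.Opens} (h : W ≤ x ⁻¹ᵁ V) (c : R) : pull x h (scalars q V c) = scalars (x ≫ q) W c :=
  pull_pull x q le_top h _

theorem hom_ext_of_scalars {T : Scheme.{0}} {x y : T ⟶ Spec (CommRingCat.of R)}
    (h : ∀ c, scalars x ⊤ c = scalars y ⊤ c) : x = y := by
  refine hom_ext_of_isAffineOpen (isAffineOpen_top _) (hx := le_top) (hy := le_top) ?_
  ext s
  have hs : s = (Scheme.ΓSpecIso (CommRingCat.of R)).inv.hom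
      ((Scheme.ΓSpecIso (CommRingCat.of R)).hom.hom s) :=
    congr($((Scheme.ΓSpecIso (CommRingCat.of R)).hom_inv_id).hom s).symm
  rw [hs]
  exact h _

theorem scalars_comp_specMap {R' : Type} [CommRing R'] {T : Scheme.{0}}
    (q : T ⟶ Spec (CommRingCat.of R')) (φ : R →+* R') (U : T.Opens) (c : R) :
    scalars (q ≫ Spec.map (CommRingCat.ofHom φ)) U c = scalars q U (φ c) := by
  rw [← pull_scalars q _ (V := ⊤) le_top]
  refine congrArg (pull q _) ?_
  have := Scheme.ΓSpecIso_inv_naturality (CommRingCat.ofHom φ)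
  refine .trans ?_ congr($(this).hom c).symm
  exact congr($(Scheme.Hom.appLE_eq_app (f := Spec.map (CommRingCat.ofHom φ)) (U := ⊤)).hom _)

theorem le_preimage_ι {T : Scheme.{0}} (U : T.Opens) : ⊤ ≤ U.ι ⁻¹ᵁ U :=
  (Scheme.Opens.ι_preimage_self U).ge

theorem pull_ι {T : Scheme.{0}} (U : T.Opens) (s : Γ(T, U)) :
    pull U.ι (le_preimage_ι U) s = U.topIso.inv.hom s := by
  have : U.ι.appLE U ⊤ (le_preimage_ι U) = U.topIso.inv := by
    rw [Scheme.Opens.ι_appLE]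
    rfl
  exact congr($(this).hom s)

theorem pull_ι_injective {T : Scheme.{0}} (U : T.Opens) :
    Function.Injective (pull U.ι (le_preimage_ι U)) := by
  intro s t h
  rw [pull_ι, pull_ι] at h
  have := congrArg U.topIso.hom.hom h
  have h1 (s : Γ(T, U)) : U.topIso.hom.hom (U.topIso.inv.hom s) = s :=
    congr($(U.topIso.inv_hom_id).hom s)
  rwa [h1, h1] at this

theorem scalars_eq_of_toSpec {T : Scheme.{0}} (q : T ⟶ Spec (CommRingCat.of R)) {U : T.Opens}
    (ψ : R →+* Γ(T, U)) (h : U.ι ≫ q = U.toSpecΓ ≫ Spec.map (CommRingCat.ofHom ψ)) (c : R) :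
    scalars q U c = ψ c := by
  apply pull_ι_injective U
  rw [pull_scalars U.ι q (le_preimage_ι U), h]
  refine (scalars_comp_specMap (R' := Γ(T, U)) U.toSpecΓ ψ ⊤ c).trans ?_
  rw [pull_ι]
  refine (congr($(Scheme.Hom.appLE_eq_app (f := U.toSpecΓ) (U := ⊤)).hom
      ((Scheme.ΓSpecIso Γ(T, U)).inv.hom (ψ c)))).trans ?_
  refine (congr($(Scheme.Opens.toSpecΓ_appTop U).hom _)).trans ?_
  exact congrArg U.topIso.inv.hom congr($((Scheme.ΓSpecIso Γ(T, U)).inv_hom_id).hom (ψ c))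

end Scalars

/-! ## Projective space -/

theorem basicOpen_ι_toSpecZero {A : Type} [CommRing A] {τ : Type} [SetLike τ A]
    [AddSubgroupClass τ A] (𝒜 : ℕ → τ) [GradedRing 𝒜] {f : A} {m : ℕ} (hf : f ∈ 𝒜 m)
    (hm : 0 < m) : (Proj.basicOpen 𝒜 f).ι ≫ Proj.toSpecZero 𝒜 =
      (Proj.basicOpen 𝒜 f).toSpecΓ ≫ Spec.map (Proj.awayToSection 𝒜 f) ≫
        Spec.map (CommRingCat.ofHom (HomogeneousLocalization.fromZeroRingHom 𝒜 _)) := by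
  have h1 := Proj.awayι_toSpecZero 𝒜 f hf hm
  rw [Proj.awayι, Category.assoc, Iso.inv_comp_eq, Proj.basicOpenIsoSpec_hom,
    Proj.basicOpenToSpec, Category.assoc] at h1
  exact h1

namespace ProjectiveSpace

open MvPolynomial HomogeneousLocalization

/-- This is the change of chart for forms: rescaling all coordinates by `c` rescales the value by `c
^ n`. -/
theorem eval₂_mul_of_isHomogeneous {σ R S : Type*} [CommRing R] [CommRing S] (f : R →+* S)
    (g : σ → S) (c : S) {F : MvPolynomial σ R} {n : ℕ} (hF : F.IsHomogeneous n) :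
    eval₂ f (fun b => c * g b) F = c ^ n * eval₂ f g F := by
  rw [eval₂_eq, eval₂_eq, Finset.mul_sum]
  refine Finset.sum_congr rfl fun s hs => ?_
  simp_rw [mul_pow]
  rw [Finset.prod_mul_distrib, Finset.prod_pow_eq_pow_sum, ← hF.degree_eq_sum_deg_support hs]
  ring

variable (R : Type) [CommRing R] (N : ℕ)

theorem isAffineOpen_chart (a : Fin (N + 1)) : IsAffineOpen (chart R N a) :=
  Proj.isAffineOpen_basicOpen (grading R N) (X a) (isHomogeneous_X R a) one_pos

theorem scalars_toBase (a : Fin (N + 1)) (c : R) :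
    scalars (toBase R N) (chart R N a) c = (Proj.awayToSection (grading R N) (X a)).hom
      (fromZeroRingHom (grading R N) _ (algebraMap R (grading R N 0) c)) := by
  refine scalars_eq_of_toSpec (toBase R N) (U := chart R N a)
    ((Proj.awayToSection (grading R N) (X a)).hom.comp
      ((fromZeroRingHom (grading R N) _).comp (algebraMap R (grading R N 0)))) ?_ c
  refine (Category.assoc _ _ _).symm.trans ((congrArg (· ≫ _)
    (basicOpen_ι_toSpecZero (grading R N) (isHomogeneous_X R a) one_pos)).trans ?_)
  refine (Category.assoc _ _ _).trans (congrArg ((chart R N a).toSpecΓ ≫ ·) ?_)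
  refine (congrArg (· ≫ _) (Spec.map_comp _ _).symm).trans (Spec.map_comp _ _).symm

/-- The fraction `F / X_a ^ n` is the value of `F` at the ratios `X_b / X_a`. The identity is
checked in the full localization at `X_a`, where `F` can be rescaled by `1 / X_a`. -/
theorem awayToSection_mk (a : Fin (N + 1)) {n : ℕ} {F : MvPolynomial (Fin (N + 1)) R}
    (hF : F ∈ grading R N (n • 1)) :
    (Proj.awayToSection (grading R N) (X a)).hom
      (Away.mk (grading R N) (d := 1) (isHomogeneous_X R a) n F hF) =
      eval₂ (scalars (toBase R N) (chart R N a)) (ratio R N a) F := by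
  have h1 : scalars (toBase R N) (chart R N a) = (Proj.awayToSection (grading R N) (X a)).hom.comp
      ((fromZeroRingHom (grading R N) (Submonoid.powers (X a))).comp
        (algebraMap R (grading R N 0))) :=
    RingHom.ext (scalars_toBase R N a)
  rw [h1]
  let z := eval₂ ((fromZeroRingHom (grading R N) (Submonoid.powers (X a))).comp
    (algebraMap R (grading R N 0))) (fun b : Fin (N + 1) =>
      (Away.mk (grading R N) (d := 1) (isHomogeneous_X R a) 1
      (X b) (isHomogeneous_X R b) : HomogeneousLocalization.Away (grading R N) (X a))) F
  have hz : Away.mk (grading R N) (d := 1) (isHomogeneous_X R a) n F hF = z := by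
    apply HomogeneousLocalization.val_injective
    let v : HomogeneousLocalization.Away (grading R N) (X a) →+*
        Localization.Away (X a : MvPolynomial (Fin (N + 1)) R) :=
      algebraMap _ _
    change _ = v z
    let j : MvPolynomial (Fin (N + 1)) R →+*
        Localization.Away (X a : MvPolynomial (Fin (N + 1)) R) :=
      algebraMap _ _
    let c : Localization.Away (X a : MvPolynomial (Fin (N + 1)) R) :=
      Localization.mk 1 ⟨X a, 1, pow_one _⟩
    have hn : F.IsHomogeneous n := by simpa using hF
    have h2 : v.comp ((fromZeroRingHom (grading R N) _).comp (algebraMap R (grading R N 0))) =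
        j.comp C := by
      ext r
      rfl
    have h3 (b : Fin (N + 1)) : v (Away.mk (grading R N) (d := 1) (isHomogeneous_X R a) 1 (X b)
        (isHomogeneous_X R b)) = c * j (X b) := by
      refine (Away.val_mk (grading R N) 1 (isHomogeneous_X R a) (X b)
        (isHomogeneous_X R b)).trans ?_
      rw [mul_comm, ← Localization.mk_one_eq_algebraMap, Localization.mk_mul]
      simp
    have h4 : v z = eval₂ (j.comp C) (fun b => c * j (X b)) F := by
      rw [hom_eval₂, h2]
      simp_rw [h3]
    rw [h4, eval₂_mul_of_isHomogeneous _ _ _ hn]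
    have h5 : eval₂ (j.comp C) (fun b => j (X b)) F = j F := by
      rw [← hom_eval₂, eval₂_eta]
    rw [h5, mul_comm, ← Localization.mk_one_eq_algebraMap, Localization.mk_pow, Localization.mk_mul]
    refine (Away.val_mk (grading R N) n (isHomogeneous_X R a) F hF).trans ?_
    simp only [one_pow, mul_one, one_mul]
    rfl
  rw [hz]
  exact hom_eval₂ F _ (Proj.awayToSection (grading R N) (X a)).hom _

/-- Every function on `X_a ≠ 0` is a polynomial in the functions `X_b / X_a`. -/
theorem exists_eval₂_ratio (a : Fin (N + 1)) (s : Γ(ProjectiveSpace R N, chart R N a)) :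
    ∃ F : MvPolynomial (Fin (N + 1)) R,
      eval₂ (scalars (toBase R N) (chart R N a)) (ratio R N a) F = s := by
  let e := Proj.basicOpenIsoAway (grading R N) (X a) (isHomogeneous_X R a) one_pos
  obtain ⟨n, F, hF, h⟩ := Away.mk_surjective (grading R N) (isHomogeneous_X R a) (e.inv.hom s)
  refine ⟨F, ?_⟩
  rw [← awayToSection_mk R N a hF, h]
  exact congr($(e.inv_hom_id).hom s)

theorem hom_ext_of_ratio {T : Scheme.{0}} {x y : T ⟶ ProjectiveSpace R N} (a : Fin (N + 1))
    (hx : ⊤ ≤ x ⁻¹ᵁ chart R N a) (hy : ⊤ ≤ y ⁻¹ᵁ chart R N a)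
    (hbase : x ≫ toBase R N = y ≫ toBase R N)
    (h : ∀ b, pull x hx (ratio R N a b) = pull y hy (ratio R N a b)) : x = y := by
  refine hom_ext_of_isAffineOpen (isAffineOpen_chart R N a) hx hy (RingHom.ext fun s => ?_)
  obtain ⟨F, rfl⟩ := exists_eval₂_ratio R N a s
  rw [hom_eval₂, hom_eval₂]
  congr 1
  · ext c
    simp only [RingHom.comp_apply]
    rw [pull_scalars, pull_scalars, hbase]
  · exact funext h

/-- Evaluation at `r` sends `X_a` to `1`, so it extends to the localization at `X_a`; its
degree-zero part is the coordinate ring of the chart. -/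
theorem exists_hom_of_ratio {T : Scheme.{0}} (q : T ⟶ Spec (CommRingCat.of R)) (a : Fin (N + 1))
    (r : Fin (N + 1) → Γ(T, ⊤)) (hr : r a = 1) :
    ∃ (x : T ⟶ ProjectiveSpace R N) (hx : ⊤ ≤ x ⁻¹ᵁ chart R N a), x ≫ toBase R N = q ∧
      ∀ b, pull x hx (ratio R N a b) = r b := by
  let e := Proj.basicOpenIsoAway (grading R N) (X a) (isHomogeneous_X R a) one_pos
  let ev : MvPolynomial (Fin (N + 1)) R →+* Γ(T, ⊤) := eval₂Hom (scalars q ⊤) r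
  have hev : IsUnit (ev (X a)) := by
    rw [eval₂Hom_X', hr]
    exact isUnit_one
  let lift : Localization.Away (X a : MvPolynomial (Fin (N + 1)) R) →+* Γ(T, ⊤) :=
    IsLocalization.Away.lift (X a : MvPolynomial (Fin (N + 1)) R) hev
  have hlift (F) : lift (algebraMap _ _ F) = ev F := IsLocalization.Away.lift_eq _ hev F
  let v : HomogeneousLocalization.Away (grading R N) (X a) →+*
    Localization.Away (X a : MvPolynomial (Fin (N + 1)) R) := algebraMap _ _
  let g : HomogeneousLocalization.Away (grading R N) (X a) →+* Γ(T, ⊤) := lift.comp v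
  obtain ⟨x, hx, hxg⟩ := exists_hom_of_isAffineOpen (isAffineOpen_chart R N a) (g.comp e.inv.hom)
  have key (z : HomogeneousLocalization.Away (grading R N) (X a)) :
      pull x hx ((Proj.awayToSection (grading R N) (X a)).hom z) = g z := by
    rw [hxg]
    exact congrArg g congr($(e.hom_inv_id).hom z)
  refine ⟨x, hx, hom_ext_of_scalars fun c => ?_, fun b => ?_⟩
  · rw [← pull_scalars x (toBase R N) hx, scalars_toBase, key]
    refine (hlift (C c)).trans ?_
    exact eval₂Hom_C _ _ _
  · refine (key _).trans ?_
    have h1 : v (Away.mk (grading R N) (d := 1) (isHomogeneous_X R a) 1 (X b)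
        (isHomogeneous_X R b)) * algebraMap _ _ (X a : MvPolynomial (Fin (N + 1)) R) =
        algebraMap _ _ (X b : MvPolynomial (Fin (N + 1)) R) := by
      refine (congrArg (· * _)
        (Away.val_mk (grading R N) 1 (isHomogeneous_X R a) (X b) (isHomogeneous_X R b))).trans ?_
      rw [← Localization.mk_one_eq_algebraMap, Localization.mk_mul,
        ← Localization.mk_one_eq_algebraMap, Localization.mk_eq_mk_iff, Localization.r_iff_exists]
      exact ⟨1, by simp; ring⟩
    have h2 := congrArg lift h1
    rw [map_mul, hlift, hlift] at h2
    rw [eval₂Hom_X', eval₂Hom_X', hr, mul_one] at h2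
    exact h2

/-- The intersection of two standard open subsets. -/
theorem chart_inf_chart (a b : Fin (N + 1)) : chart R N a ⊓ chart R N b =
    (ProjectiveSpace R N).basicOpen (ratio R N a b) := by
  apply le_antisymm
  · have hu : IsUnit (res (inf_le_left : chart R N a ⊓ chart R N b ≤ _) (ratio R N a b)) :=
      ((O1 R N).g a b).isUnit
    have := (Scheme.basicOpen_of_isUnit _ hu).ge
    rw [show res (inf_le_left : chart R N a ⊓ chart R N b ≤ _) (ratio R N a b) =
      ((ProjectiveSpace R N).presheaf.map (homOfLE inf_le_left).op).hom (ratio R N a b) from rfl,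
      Scheme.basicOpen_res] at this
    exact this.trans inf_le_right
  -- At a point `p` where `X_b / X_a` is invertible, the fraction is a unit in the local ring at
  -- `p`, so its numerator `X_b` lies outside the prime.
  · refine le_inf (Scheme.basicOpen_le _ _) fun p hp => ?_
    have hW : (ProjectiveSpace R N).basicOpen (ratio R N a b) ≤ chart R N a :=
      Scheme.basicOpen_le _ _
    have hu : IsUnit (res hW (ratio R N a b)) :=
      RingedSpace.isUnit_res_basicOpen (ProjectiveSpace R N).toRingedSpace _
    obtain ⟨w, hw⟩ := hu.exists_right_inv
    by_contra hpb
    let q : ((ProjectiveSpace R N).basicOpen (ratio R N a b) :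
      TopologicalSpace.Opens (ProjectiveSpectrum.top (grading R N))) := ⟨p, hp⟩
    have := q.1.isPrime
    have h1 : X a ^ 1 ∈ (HomogeneousIdeal.toIdeal q.1.asHomogeneousIdeal).primeCompl := by
      rw [pow_one]
      exact hW hp
    have h2 := congrArg (fun s : Γ(ProjectiveSpace R N, (ProjectiveSpace R N).basicOpen
      (ratio R N a b)) => (((s :) : (ProjectiveSpectrum.Proj.structureSheaf (grading R N)).1.obj
        (.op ((ProjectiveSpace R N).basicOpen (ratio R N a b)))).1 q).val) hw
    have h3 : Localization.mk (X b : MvPolynomial (Fin (N + 1)) R) ⟨X a ^ 1, h1⟩ *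
        (((w :) : (ProjectiveSpectrum.Proj.structureSheaf (grading R N)).1.obj
        (.op ((ProjectiveSpace R N).basicOpen (ratio R N a b)))).1 q).val = 1 :=
      (HomogeneousLocalization.val_mul _ _).symm.trans
        (h2.trans (HomogeneousLocalization.val_one (𝒜 := grading R N)))
    have h4 := IsUnit.of_mul_eq_one _ h3
    rw [Localization.mk_eq_mk'] at h4
    exact (IsLocalization.AtPrime.isUnit_mk'_iff (Localization.AtPrime
      (HomogeneousIdeal.toIdeal q.1.asHomogeneousIdeal)) _ _ _).mp h4 (by_contra hpb)

end ProjectiveSpace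

/-! ## The Veronese embedding -/

namespace ProjectiveSpace

/-! ### Ratios of homogeneous coordinates on a scheme over projective space -/

section PullRatio

variable {R : Type} [CommRing R] {N : ℕ} {T : Scheme.{0}} (x : T ⟶ ProjectiveSpace R N)
  {W : T.Opens}

theorem pull_ratio_self {a : Fin (N + 1)} (ha : W ≤ x ⁻¹ᵁ chart R N a) :
    pull x ha (ratio R N a a) = 1 := by
  rw [ratio_self, map_one]

theorem pull_ratio_mul {a b : Fin (N + 1)} (c : Fin (N + 1)) (ha : W ≤ x ⁻¹ᵁ chart R N a)
    (hb : W ≤ x ⁻¹ᵁ chart R N b) :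
    pull x ha (ratio R N a b) * pull x hb (ratio R N b c) = pull x ha (ratio R N a c) := by
  have h := congrArg (pull x (le_preimage_inf ha hb))
    (ratio_mul R N a b c (W := chart R N a ⊓ chart R N b) inf_le_left inf_le_right)
  rwa [map_mul, pull_res, pull_res, pull_res] at h

theorem isUnit_pull_ratio {a b : Fin (N + 1)} (ha : W ≤ x ⁻¹ᵁ chart R N a)
    (hb : W ≤ x ⁻¹ᵁ chart R N b) : IsUnit (pull x ha (ratio R N a b)) :=
  IsUnit.of_mul_eq_one (pull x hb (ratio R N b a))
    ((pull_ratio_mul x a ha hb).trans (pull_ratio_self x ha))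

theorem le_preimage_chart_of_isUnit {a b : Fin (N + 1)} (ha : W ≤ x ⁻¹ᵁ chart R N a)
    (h : IsUnit (pull x ha (ratio R N a b))) : W ≤ x ⁻¹ᵁ chart R N b := by
  have h1 : T.basicOpen (pull x ha (ratio R N a b)) = W := Scheme.basicOpen_of_isUnit _ h
  have h2 : T.basicOpen (pull x ha (ratio R N a b)) =
      W ⊓ x ⁻¹ᵁ (ProjectiveSpace R N).basicOpen (ratio R N a b) :=
    Scheme.basicOpen_appLE x W (chart R N a) ha (ratio R N a b)
  rw [← chart_inf_chart] at h2
  refine (h1.symm.trans h2).le.trans (inf_le_right.trans ?_)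
  exact x.preimage_mono inf_le_right

theorem exists_mem_preimage_chart (t : T) : ∃ a, t ∈ x ⁻¹ᵁ chart R N a := by
  have h : x.base t ∈ (⨆ a, chart R N a : (ProjectiveSpace R N).Opens) := by
    rw [show ⨆ a, chart R N a = ⊤ from (O1 R N).iSup_U]
    trivial
  obtain ⟨a, ha⟩ := TopologicalSpace.Opens.mem_iSup.mp h
  exact ⟨a, ha⟩

theorem iSup_preimage_chart : ⨆ a, x ⁻¹ᵁ chart R N a = ⊤ := by
  refine top_le_iff.mp fun t _ => ?_
  exact TopologicalSpace.Opens.mem_iSup.mpr (exists_mem_preimage_chart x t)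

end PullRatio

/-! ### Construction and properties of the Veronese morphism -/

section Veronese

variable {R : Type} [CommRing R] {N M m : ℕ} (ε : Fin (M + 1) ≃ (Fin m → Fin (N + 1)))
  {Y : Scheme.{0}}

/-- The morphism `v` is the composition of `e` with the map to projective space given by all
monomials of degree `m`, with the word `ε a` as the monomial of index `a`. -/
def IsVeronese (e : Y ⟶ ProjectiveSpace R N) (v : Y ⟶ ProjectiveSpace R M) : Prop :=
  v ≫ toBase R M = e ≫ toBase R N ∧
    ∀ i, ∃ h : e ⁻¹ᵁ chart R N i ≤ v ⁻¹ᵁ chart R M (ε.symm fun _ => i),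
      ∀ b, pull v h (ratio R M _ b) = ∏ l, pull e le_rfl (ratio R N i (ε b l))

/-- Where `X_i ≠ 0` the morphism is given by the ratios of all monomials to `X_i ^ m`. Passing from
`i` to `j` multiplies all of them by one common unit, so the local morphisms glue. -/
theorem exists_isVeronese (e : Y ⟶ ProjectiveSpace R N) : ∃ v, IsVeronese ε e v := by
  let V (i : Fin (N + 1)) : Y.Opens := e ⁻¹ᵁ chart R N i
  let c (i : Fin (N + 1)) : Fin (M + 1) := ε.symm fun _ => i
  have hc (i : Fin (N + 1)) (l : Fin m) : ε (c i) l = i := by simp [c]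
  have hV (i : Fin (N + 1)) : ⊤ ≤ ((V i).ι ≫ e) ⁻¹ᵁ chart R N i := le_preimage_ι (V i)
  have hx (i : Fin (N + 1)) := exists_hom_of_ratio R M ((V i).ι ≫ e ≫ toBase R N) (c i)
    (fun b => ∏ l, pull ((V i).ι ≫ e) (hV i) (ratio R N i (ε b l)))
    (Finset.prod_eq_one fun l _ => by rw [hc, pull_ratio_self])
  choose x hxc hxq hxr using hx
  let 𝒰 := Y.openCoverOfIsOpenCover V (iSup_preimage_chart e)
  have hglue (i j : Fin (N + 1)) : Limits.pullback.fst (V i).ι (V j).ι ≫ x i =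
      Limits.pullback.snd (V i).ι (V j).ι ≫ x j := by
    set f₁ := Limits.pullback.fst (V i).ι (V j).ι
    set f₂ := Limits.pullback.snd (V i).ι (V j).ι
    have hf : f₁ ≫ (V i).ι ≫ e = f₂ ≫ (V j).ι ≫ e := by
      rw [← Category.assoc, Limits.pullback.condition, Category.assoc]
    have h₁ : ⊤ ≤ (f₁ ≫ (V i).ι ≫ e) ⁻¹ᵁ chart R N i := fun t _ => hV i trivial
    have h₂ : ⊤ ≤ (f₂ ≫ (V j).ι ≫ e) ⁻¹ᵁ chart R N j := fun t _ => hV j trivial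
    have h₂' : ⊤ ≤ (f₂ ≫ (V j).ι ≫ e) ⁻¹ᵁ chart R N i := hf ▸ h₁
    have hxi : ⊤ ≤ (f₁ ≫ x i) ⁻¹ᵁ chart R M (c i) := fun t _ => hxc i trivial
    have hxj : ⊤ ≤ (f₂ ≫ x j) ⁻¹ᵁ chart R M (c j) := fun t _ => hxc j trivial
    have hri (b : Fin (M + 1)) : pull (f₁ ≫ x i) hxi (ratio R M (c i) b) =
        ∏ l, pull (f₁ ≫ (V i).ι ≫ e) h₁ (ratio R N i (ε b l)) := by
      rw [← pull_pull f₁ (x i) (hxc i) le_top, hxr, map_prod]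
      exact Finset.prod_congr rfl fun l _ => pull_pull _ _ _ _ _
    have hrj (b : Fin (M + 1)) : pull (f₂ ≫ x j) hxj (ratio R M (c j) b) =
        ∏ l, pull (f₂ ≫ (V j).ι ≫ e) h₂ (ratio R N j (ε b l)) := by
      rw [← pull_pull f₂ (x j) (hxc j) le_top, hxr, map_prod]
      exact Finset.prod_congr rfl fun l _ => pull_pull _ _ _ _ _
    -- In the chart of `X_j ^ m` the coordinate of `X_i ^ m` is `(X_i / X_j) ^ m`, a unit on the
    -- overlap; hence the second morphism also lands in the chart of `X_i ^ m`.
    have hu : IsUnit (pull (f₂ ≫ x j) hxj (ratio R M (c j) (c i))) := by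
      rw [hrj]
      refine IsUnit.prod_univ_iff.mpr fun l => ?_
      rw [hc]
      exact isUnit_pull_ratio _ h₂ h₂'
    have hxj' := le_preimage_chart_of_isUnit (f₂ ≫ x j) hxj hu
    refine hom_ext_of_ratio R M (c i) hxi hxj' ?_ fun b => ?_
    · rw [Category.assoc, Category.assoc, hxq, hxq]
      simpa only [Category.assoc] using congrArg (· ≫ toBase R N) hf
    · refine hu.mul_left_cancel ?_
      rw [pull_ratio_mul, hri, hrj, hrj, ← Finset.prod_mul_distrib]
      refine Finset.prod_congr rfl fun l _ => ?_
      rw [hc, pull_congr hf h₁ h₂', pull_ratio_mul]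
  let v : Y ⟶ ProjectiveSpace R M := 𝒰.glueMorphisms x hglue
  have hv (i : Fin (N + 1)) : (V i).ι ≫ v = x i := 𝒰.ι_glueMorphisms x hglue i
  refine ⟨v, ?_, fun i => ?_⟩
  · refine 𝒰.hom_ext _ _ fun i => ?_
    exact (Category.assoc _ _ _).symm.trans ((congrArg (· ≫ _) (hv i)).trans (hxq i))
  · have h : V i ≤ v ⁻¹ᵁ chart R M (c i) := by
      intro t ht
      have := hxc i (show (⟨t, ht⟩ : (V i).toScheme) ∈ ⊤ from trivial)
      rw [← hv i] at this
      exact this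
    refine ⟨h, fun b => pull_ι_injective (V i) ?_⟩
    rw [pull_pull, map_prod]
    refine (pull_congr (hv i) _ (hxc i) _).trans ((hxr i b).trans ?_)
    exact Finset.prod_congr rfl fun l _ => (pull_pull _ _ _ _ _).symm

namespace IsVeronese

variable {ε} {e : Y ⟶ ProjectiveSpace R N} {v : Y ⟶ ProjectiveSpace R M} (hv : IsVeronese ε e v)
include hv

theorem le_preimage (i : Fin (N + 1)) :
    e ⁻¹ᵁ chart R N i ≤ v ⁻¹ᵁ chart R M (ε.symm fun _ => i) := (hv.2 i).1

theorem pull_ratio_const {i : Fin (N + 1)} {W : Y.Opens} (hW : W ≤ e ⁻¹ᵁ chart R N i)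
    (b : Fin (M + 1)) : pull v (hW.trans (hv.le_preimage i)) (ratio R M (ε.symm fun _ => i) b) =
      ∏ l, pull e hW (ratio R N i (ε b l)) := by
  rw [← res_pull v (hv.le_preimage i) hW, (hv.2 i).2, map_prod]
  exact Finset.prod_congr rfl fun l _ => res_pull e le_rfl hW _

/-- A monomial is invertible only where each of its factors is. -/
theorem preimage_le (b : Fin (M + 1)) (l : Fin m) :
    v ⁻¹ᵁ chart R M b ≤ e ⁻¹ᵁ chart R N (ε b l) := by
  intro t ht
  obtain ⟨i, hi⟩ := exists_mem_preimage_chart e t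
  have h1 : v ⁻¹ᵁ chart R M b ⊓ e ⁻¹ᵁ chart R N i ≤ e ⁻¹ᵁ chart R N i := inf_le_right
  have h2 := isUnit_pull_ratio v (h1.trans (hv.le_preimage i)) inf_le_left
  rw [hv.pull_ratio_const h1] at h2
  exact le_preimage_chart_of_isUnit e h1 (IsUnit.prod_univ_iff.mp h2 l) ⟨ht, hi⟩

/-- The formula is known relative to a pure power `X_i ^ m`. With `X_i` the first letter of the word
`ε a`, both sides are multiplied by the unit comparing `a` with `X_i ^ m`. -/
theorem pull_ratio (hm : 0 < m) {a b : Fin (M + 1)} {W : Y.Opens} (ha : W ≤ v ⁻¹ᵁ chart R M a)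
    (_hb : W ≤ v ⁻¹ᵁ chart R M b) : pull v ha (ratio R M a b) =
      ∏ l, pull e (ha.trans (hv.preimage_le a l)) (ratio R N (ε a l) (ε b l)) := by
  have hi := ha.trans (hv.preimage_le a ⟨0, hm⟩)
  have hu := isUnit_pull_ratio v (hi.trans (hv.le_preimage _)) ha
  refine hu.mul_left_cancel ?_
  rw [pull_ratio_mul, hv.pull_ratio_const hi, hv.pull_ratio_const hi, ← Finset.prod_mul_distrib]
  exact Finset.prod_congr rfl fun l _ => (pull_ratio_mul e _ _ _).symm

/-- The ratio `X_j / X_i` is recovered from the Veronese coordinates as `X_i ^ (m - 1) X_j / X_i ^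
m`, so `x ≫ v` determines `x ≫ e`. -/
theorem mono (hm : 0 < m) [Mono e] : Mono v := by
  refine ⟨fun {T} x y hxy => ?_⟩
  rw [← cancel_mono e]
  refine Scheme.hom_ext_of_forall _ _ fun t => ?_
  obtain ⟨i, hi⟩ := exists_mem_preimage_chart (x ≫ e) t
  refine ⟨(x ≫ e) ⁻¹ᵁ chart R N i, hi, ?_⟩
  set U := (x ≫ e) ⁻¹ᵁ chart R N i
  let c := ε.symm fun _ => i
  have hc : e ⁻¹ᵁ chart R N i = v ⁻¹ᵁ chart R M c := by
    refine le_antisymm (hv.le_preimage i) ?_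
    have := hv.preimage_le c ⟨0, hm⟩
    rwa [ε.apply_symm_apply] at this
  have hy : (y ≫ e) ⁻¹ᵁ chart R N i = U := by
    refine (congrArg (y ⁻¹ᵁ ·) hc).trans (.trans ?_ (congrArg (x ⁻¹ᵁ ·) hc).symm)
    exact congrArg (fun z : T ⟶ ProjectiveSpace R M => z ⁻¹ᵁ chart R M c) hxy.symm
  have hx1 : ⊤ ≤ (U.ι ≫ x ≫ e) ⁻¹ᵁ chart R N i := le_preimage_ι U
  have hy1 : ⊤ ≤ (U.ι ≫ y ≫ e) ⁻¹ᵁ chart R N i := by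
    intro t ht
    exact hy.ge (le_preimage_ι U ht)
  refine hom_ext_of_ratio R N i hx1 hy1 ?_ fun j => ?_
  · simp only [Category.assoc]
    rw [← hv.1, reassoc_of% hxy]
  -- The word with first letter `j` and all other letters `i`.
  · let b := ε.symm (Function.update (fun _ => i) ⟨0, hm⟩ j)
    have key (z : T ⟶ Y) (hz : ⊤ ≤ (U.ι ≫ z ≫ e) ⁻¹ᵁ chart R N i)
        (hz' : ⊤ ≤ (U.ι ≫ z ≫ v) ⁻¹ᵁ chart R M c) :
        pull (U.ι ≫ z ≫ e) hz (ratio R N i j) = pull (U.ι ≫ z ≫ v) hz' (ratio R M c b) := by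
      have h1 := congrArg (pull (U.ι ≫ z) (W := ⊤) (V := e ⁻¹ᵁ chart R N i) hz)
        (hv.pull_ratio_const le_rfl b)
      have h2 : ∏ l, pull e (le_refl (e ⁻¹ᵁ chart R N i)) (ratio R N i (ε b l)) =
          pull e le_rfl (ratio R N i j) := by
        rw [Finset.prod_eq_single ⟨0, hm⟩]
        · simp only [b, ε.apply_symm_apply, Function.update_self]
        · intro l _ hl
          simp only [b, ε.apply_symm_apply, Function.update_of_ne hl]
          rw [pull_ratio_self]
        · simp
      rw [h2] at h1
      refine (pull_congr (Category.assoc _ _ _).symm hz hz _).trans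
        ((pull_pull _ e _ _ _).symm.trans (h1.symm.trans ((pull_pull _ v _ _ _).trans ?_)))
      exact pull_congr (Category.assoc _ _ _) _ _ _
    have hx2 : ⊤ ≤ (U.ι ≫ x ≫ v) ⁻¹ᵁ chart R M c := fun t ht => hc.le (hx1 ht)
    have hy2 : ⊤ ≤ (U.ι ≫ y ≫ v) ⁻¹ᵁ chart R M c := fun t ht => hc.le (hy1 ht)
    rw [key x hx1 hx2, key y hy1 hy2]
    exact pull_congr (by rw [hxy]) _ _ _

/-! ### The pull-back of the twisting sheaf under the Veronese morphism -/

section BundleIso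

variable {L : LineBundle Y} (η : LineBundle.Iso ((O1 R N).pullback e) L)

/-- The unit by which the frame `X_i` of `𝒪(1)` differs from a frame of the line bundle. -/
def coordinateUnit (i : Fin (N + 1)) (j : L.ι) : Γ(Y, e ⁻¹ᵁ chart R N i ⊓ L.U j)ˣ := η.h i j

/-- The unit by which the frame of the pull-back of `𝒪(1)` under the Veronese embedding differs from
a frame of the power of the line bundle. -/
def frameUnit (a : Fin (M + 1)) (j : L.ι) : Γ(Y, v ⁻¹ᵁ chart R M a ⊓ L.U j)ˣ :=
  ∏ l, Units.map (RingHom.toMonoidHom (res (V := e ⁻¹ᵁ chart R N (ε a l) ⊓ L.U j)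
    (W := v ⁻¹ᵁ chart R M a ⊓ L.U j)
    (le_inf (inf_le_left.trans (hv.preimage_le a l)) inf_le_right))) (coordinateUnit η (ε a l) j)

theorem res_frameUnit (a : Fin (M + 1)) (j : L.ι) {W : Y.Opens} (ha : W ≤ v ⁻¹ᵁ chart R M a)
    (hj : W ≤ L.U j) : res (le_inf ha hj) (hv.frameUnit η a j : Γ(Y, v ⁻¹ᵁ chart R M a ⊓ L.U j)) =
      ∏ l, res (le_inf (ha.trans (hv.preimage_le a l)) hj)
        (coordinateUnit η (ε a l) j : Γ(Y, e ⁻¹ᵁ chart R N (ε a l) ⊓ L.U j)) := by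
  rw [frameUnit, Units.coe_prod, map_prod]
  exact Finset.prod_congr rfl fun l _ => res_res _ _ _

theorem res_frameUnit_left (hm : 0 < m) (a a' : Fin (M + 1)) (j : L.ι) {W : Y.Opens}
    (ha : W ≤ v ⁻¹ᵁ chart R M a) (ha' : W ≤ v ⁻¹ᵁ chart R M a') (hj : W ≤ L.U j) :
    res (le_inf ha' hj) (hv.frameUnit η a' j : Γ(Y, v ⁻¹ᵁ chart R M a' ⊓ L.U j)) =
      res (le_inf ha hj) (hv.frameUnit η a j : Γ(Y, v ⁻¹ᵁ chart R M a ⊓ L.U j)) *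
        pull v ha (ratio R M a a') := by
  rw [hv.pull_ratio hm ha ha', hv.res_frameUnit η a' j ha' hj, hv.res_frameUnit η a j ha hj,
    ← Finset.prod_mul_distrib]
  refine Finset.prod_congr rfl fun l _ => ?_
  refine (η.left (ε a l) (ε a' l) j W (ha.trans (hv.preimage_le a l))
    (ha'.trans (hv.preimage_le a' l)) hj).trans (congrArg (_ * ·) ?_)
  exact (res_pull e _ _ _).trans (pull_res e _ _ _)

theorem res_frameUnit_right (a : Fin (M + 1)) (j j' : L.ι) {W : Y.Opens}
    (ha : W ≤ v ⁻¹ᵁ chart R M a) (hj : W ≤ L.U j) (hj' : W ≤ L.U j') :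
    res (le_inf ha hj) (hv.frameUnit η a j : Γ(Y, v ⁻¹ᵁ chart R M a ⊓ L.U j)) =
      res (le_inf hj hj') (L.g j j' : Γ(Y, L.U j ⊓ L.U j')) ^ m *
        res (le_inf ha hj') (hv.frameUnit η a j' : Γ(Y, v ⁻¹ᵁ chart R M a ⊓ L.U j')) := by
  have h : res (le_inf hj hj') (L.g j j' : Γ(Y, L.U j ⊓ L.U j')) ^ m =
      ∏ _l : Fin m, res (le_inf hj hj') (L.g j j' : Γ(Y, L.U j ⊓ L.U j')) := by simp
  rw [h, hv.res_frameUnit η a j ha hj, hv.res_frameUnit η a j' ha hj', ← Finset.prod_mul_distrib]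
  exact Finset.prod_congr rfl fun l _ =>
    η.right (ε a l) j j' W (ha.trans (hv.preimage_le a l)) hj hj'

/-- The pull-back of `𝒪(1)` under the Veronese embedding is `𝒪(m)`. -/
def bundleIso (hm : 0 < m) : LineBundle.Iso ((O1 R M).pullback v) (L.pow m) where
  h a j := hv.frameUnit (L := L) η a j
  left a a' j W ha ha' hj := by
    refine (hv.res_frameUnit_left η hm a a' j ha ha' hj).trans (congrArg (_ * ·) ?_)
    exact ((res_pull v _ _ _).trans (pull_res v _ _ _)).symm
  right a j j' W ha hj hj' := by
    refine (hv.res_frameUnit_right η a j j' ha hj hj').trans (congrArg (· * _) ?_)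
    exact (map_pow (res (le_inf hj hj')) (L.g j j' : Γ(Y, L.U j ⊓ L.U j')) m).symm

end BundleIso

end IsVeronese

end Veronese

instance (R : Type) [CommRing R] (N : ℕ) : IsSeparated (toBase R N) := by
  have : IsSeparated (Proj.toSpecZero (grading R N)) := inferInstance
  exact MorphismProperty.comp_mem _ _ _ this inferInstance

end ProjectiveSpace

/-- A positive power of a very ample line bundle is very ample. -/
theorem VeryAmple.pow {R : Type} [CommRing R] {Y : Scheme.{0}} {p : Y ⟶ Spec (CommRingCat.of R)}
    [IsProper p] {L : LineBundle Y} (h : VeryAmple p L) {m : ℕ} (hm : 0 < m) :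
    VeryAmple p (L.pow m) := by
  obtain ⟨N, e, he, hep, ⟨η⟩⟩ := h
  obtain ⟨M, hM⟩ := Nat.exists_eq_add_one.mpr
    (Fintype.card_pos : 0 < Fintype.card (Fin m → Fin (N + 1)))
  let ε : Fin (M + 1) ≃ (Fin m → Fin (N + 1)) := (Fintype.equivFinOfCardEq hM).symm
  obtain ⟨v, hv⟩ := ProjectiveSpace.exists_isVeronese ε e
  have h1 : IsProper (v ≫ ProjectiveSpace.toBase R M) := by
    rw [hv.1, hep]
    infer_instance
  -- Projective space is separated over the base, so properness passes to `v`; a proper monomorphism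
  -- is a closed immersion.
  have h2 : IsProper v := IsProper.of_comp v (ProjectiveSpace.toBase R M)
  have h3 : Mono v := hv.mono hm
  exact ⟨M, v, (IsClosedImmersion.iff_isProper_and_mono v).mpr ⟨h2, h3⟩, hv.1.trans hep,
    ⟨hv.bundleIso η hm⟩⟩

/-! ## Sections in terms of homogeneous coordinates -/

section HomogeneousCoordinates

open MvPolynomial

variable {K ι : Type} [Field K] {A : ι → Type} [∀ i, CommRing (A i)] [∀ i, Algebra K (A i)]

/-- Homogenize with `X i`, whose value is `1`. -/
theorem exists_isHomogeneous_aeval_eq {B : Type*} [CommRing B] [Algebra K B] {y : ι → B} {i : ι}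
    (hi : y i = 1) (P : MvPolynomial ι K) :
    ∃ (p : ℕ) (G : MvPolynomial ι K), G.IsHomogeneous p ∧ aeval y G = aeval y P := by
  refine ⟨P.totalDegree, ∑ m ∈ Finset.range (P.totalDegree + 1),
    X i ^ (P.totalDegree - m) * homogeneousComponent m P, ?_, ?_⟩
  · refine IsHomogeneous.sum _ _ _ fun m hm => ?_
    have h := (isHomogeneous_X_pow (R := K) i (P.totalDegree - m)).mul
      (homogeneousComponent_isHomogeneous m P)
    rwa [Nat.sub_add_cancel (Nat.lt_succ_iff.mp (Finset.mem_range.mp hm))] at h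
  · conv_rhs => rw [← sum_homogeneousComponent P]
    simp [hi]

/-- By the pigeonhole principle, a monomial of degree above `l` times the number of variables has an
exponent at least `l`. -/
theorem exists_pow_mul_monomial [Finite ι] (l : ℕ) :
    ∃ n₀ : ℕ, ∀ m : ι →₀ ℕ, n₀ ≤ m.degree → ∃ (i : ι) (m' : ι →₀ ℕ),
      m = Finsupp.single i l + m' := by
  have := Fintype.ofFinite ι
  refine ⟨Fintype.card ι * l + 1, fun m hm => ?_⟩
  obtain ⟨i, hi⟩ : ∃ i, l ≤ m i := by
    by_contra! h
    have h1 : ∑ i, m i ≤ ∑ _i : ι, l := Finset.sum_le_sum fun i _ => (h i).le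
    rw [Finsupp.degree_eq_sum] at hm
    simp only [Finset.sum_const, Finset.card_univ, smul_eq_mul] at h1
    lia
  refine ⟨i, m - Finsupp.single i l, ?_⟩
  rw [add_tsub_cancel_of_le]
  rwa [Finsupp.single_le_iff]

/-- The ideal of the polynomials whose homogeneous components vanish in the given coordinates. -/
def coordinateIdeal (y : ∀ i : ι, ι → A i) : Ideal (MvPolynomial ι K) :=
  ⨅ j, RingHom.ker (eval₂Hom (Polynomial.C.comp (algebraMap K (A j)))
    (fun b => Polynomial.X * Polynomial.C (y j b)))

theorem eval₂_C_isHomogeneous {B : Type*} [CommRing B] [Algebra K B] (y : ι → B)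
    {F : MvPolynomial ι K} {n : ℕ} (hF : F.IsHomogeneous n) :
    eval₂Hom (Polynomial.C.comp (algebraMap K B)) (fun b => Polynomial.X * Polynomial.C (y b)) F =
      Polynomial.C (aeval y F) * Polynomial.X ^ n := by
  rw [coe_eval₂Hom, ProjectiveSpace.eval₂_mul_of_isHomogeneous _ _ _ hF, mul_comm]
  congr 1
  exact (hom_eval₂ F (algebraMap K B) Polynomial.C y).symm

/-- The auxiliary variable records the degree: the component of degree `n` contributes the
coefficient of its `n`-th power, so the components vanish separately. -/
theorem mem_coordinateIdeal {y : ∀ i : ι, ι → A i} {F : MvPolynomial ι K} :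
    F ∈ coordinateIdeal y ↔ ∀ j n, aeval (y j) (homogeneousComponent n F) = 0 := by
  rw [coordinateIdeal, Ideal.mem_iInf]
  refine forall_congr' fun j => ?_
  have h : eval₂Hom (Polynomial.C.comp (algebraMap K (A j)))
      (fun b => Polynomial.X * Polynomial.C (y j b)) F = ∑ n ∈ Finset.range (F.totalDegree + 1),
        Polynomial.C (aeval (y j) (homogeneousComponent n F)) * Polynomial.X ^ n := by
    conv_lhs => rw [← sum_homogeneousComponent F, map_sum]
    exact Finset.sum_congr rfl fun n _ =>
      eval₂_C_isHomogeneous (y j) (homogeneousComponent_isHomogeneous n F)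
  rw [RingHom.mem_ker, h]
  constructor
  · intro h0 n
    rcases lt_or_ge F.totalDegree n with hn | hn
    · rw [homogeneousComponent_eq_zero _ _ hn, map_zero]
    · have := congrArg (Polynomial.coeff · n) h0
      simp only [Polynomial.finsetSum_coeff, Polynomial.coeff_C_mul_X_pow, Polynomial.coeff_zero,
        Finset.sum_ite_eq, Finset.mem_range] at this
      rwa [if_pos (by lia)] at this
  · intro h0
    exact Finset.sum_eq_zero fun n _ => by rw [h0, map_zero, zero_mul]

theorem mem_coordinateIdeal_of_isHomogeneous {y : ∀ i : ι, ι → A i} {F : MvPolynomial ι K} {n : ℕ}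
    (hF : F.IsHomogeneous n) : F ∈ coordinateIdeal y ↔ ∀ j, aeval (y j) F = 0 := by
  rw [mem_coordinateIdeal]
  refine forall_congr' fun j => ⟨fun h => ?_, fun h m => ?_⟩
  · have := h n
    rwa [homogeneousComponent_of_mem hF, if_pos rfl] at this
  · rw [homogeneousComponent_of_mem hF]
    split_ifs
    · exact h
    · exact map_zero _

theorem homogeneousClosed_coordinateIdeal (y : ∀ i : ι, ι → A i) :
    HomogeneousClosed (coordinateIdeal y : Ideal (MvPolynomial ι K)) := by
  intro F hF n
  rw [mem_coordinateIdeal_of_isHomogeneous (homogeneousComponent_isHomogeneous n F)]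
  exact fun j => mem_coordinateIdeal.mp hF j n

/-- Multiplication by the section `s` of `𝒪(1)` is given by `φ` in large degrees. -/
def Represents (y : ∀ i : ι, ι → A i) (s : ∀ i, A i)
    (φ : ℕ → MvPolynomial ι K → MvPolynomial ι K) : Prop :=
  ∃ n₀ : ℕ, ∀ n ≥ n₀, ∀ F : MvPolynomial ι K, F.IsHomogeneous n → (φ n F).IsHomogeneous (n + 1) ∧
    ∀ j, aeval (y j) (φ n F) = aeval (y j) F * s j

namespace Represents

variable {y : ∀ i : ι, ι → A i} {s t : ∀ i, A i} {φ ψ : ℕ → MvPolynomial ι K → MvPolynomial ι K}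

theorem add (h : Represents y s φ) (h' : Represents y t ψ) : Represents y (s + t) (φ + ψ) := by
  obtain ⟨n₁, h₁⟩ := h
  obtain ⟨n₂, h₂⟩ := h'
  refine ⟨max n₁ n₂, fun n hn F hF => ?_⟩
  have h₁ := h₁ n (le_of_max_le_left hn) F hF
  have h₂ := h₂ n (le_of_max_le_right hn) F hF
  refine ⟨h₁.1.add h₂.1, fun j => ?_⟩
  simp only [Pi.add_apply, map_add, h₁.2, h₂.2]
  ring

theorem smul (h : Represents y s φ) (c : K) : Represents y (c • s) (c • φ) := by
  obtain ⟨n₁, h₁⟩ := h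
  refine ⟨n₁, fun n hn F hF => ?_⟩
  have h₁ := h₁ n hn F hF
  refine ⟨(homogeneousSubmodule ι K (n + 1)).smul_mem c h₁.1, fun j => ?_⟩
  simp only [Pi.smul_apply, map_smul, h₁.2, mul_smul_comm]

theorem sub_mem (h : Represents y s φ) (h' : Represents y s ψ) :
    φ - ψ ∈ nullMaps (coordinateIdeal y) := by
  obtain ⟨n₁, h₁⟩ := h
  obtain ⟨n₂, h₂⟩ := h'
  refine ⟨max n₁ n₂, fun n hn F hF => ?_⟩
  have h₁ := h₁ n (le_of_max_le_left hn) F hF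
  have h₂ := h₂ n (le_of_max_le_right hn) F hF
  refine (mem_coordinateIdeal_of_isHomogeneous (h₁.1.sub h₂.1)).mpr fun j => ?_
  rw [map_sub, h₁.2, h₂.2, sub_self]

theorem mem_gradedMaps (h : Represents y s φ) : φ ∈ gradedMaps (coordinateIdeal y) 1 := by
  obtain ⟨n₀, h₀⟩ := h
  refine ⟨n₀, fun n hn F hF => ⟨⟨n + 1, by push_cast; rfl, (h₀ n hn F hF).1⟩, fun G hG => ?_,
    fun k G hG => ?_⟩⟩
  · have h₁ := h₀ n hn F hF
    have h₂ := h₀ n hn G hG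
    have h₃ := h₀ n hn (F + G) (hF.add hG)
    refine (mem_coordinateIdeal_of_isHomogeneous (h₃.1.sub (h₁.1.add h₂.1))).mpr fun j => ?_
    rw [map_sub, map_add, h₁.2, h₂.2, h₃.2, map_add]
    ring
  · have h₁ := h₀ n hn F hF
    have h₂ := h₀ (k + n) (by lia) (G * F) (hG.mul hF)
    have h₃ := hG.mul h₁.1
    rw [← add_assoc] at h₃
    refine (mem_coordinateIdeal_of_isHomogeneous (h₂.1.sub h₃)).mpr fun j => ?_
    rw [map_sub, map_mul, h₁.2, h₂.2, map_mul]
    ring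

/-- Test on `X j ^ n`, whose value in the chart `j` is `1`; the value of the product there is `s j`
itself. -/
theorem eq_zero (h : Represents y s φ) (hy : ∀ i, y i i = 1)
    (h' : φ ∈ nullMaps (coordinateIdeal y)) : s = 0 := by
  obtain ⟨n₁, h₁⟩ := h
  obtain ⟨n₂, h₂⟩ := h'
  funext j
  have h₁ := h₁ (max n₁ n₂) (le_max_left _ _) (X j ^ (max n₁ n₂)) (isHomogeneous_X_pow j _)
  have h₂ := h₂ (max n₁ n₂) (le_max_right _ _) (X j ^ (max n₁ n₂)) (isHomogeneous_X_pow j _)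
  have h₃ := (mem_coordinateIdeal_of_isHomogeneous h₁.1).mp h₂ j
  rwa [h₁.2, map_pow, aeval_X, hy, one_pow, one_mul] at h₃

end Represents

/-- The hypothesis says that a power of each coordinate times `s` is given by a form. A monomial of
large degree contains a high enough power of some coordinate, so its product with `s` is given by a
form too; extend linearly over monomials. -/
theorem exists_represents [Finite ι] {y : ∀ i : ι, ι → A i} {s : ∀ i, A i}
    (h : ∀ i, ∃ (n : ℕ) (G : MvPolynomial ι K), G.IsHomogeneous (n + 1) ∧
      ∀ j, aeval (y j) G = y j i ^ n * s j) :
    ∃ φ : ℕ → MvPolynomial ι K → MvPolynomial ι K, Represents y s φ := by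
  classical
  have := Fintype.ofFinite ι
  choose l G hG hGs using h
  obtain ⟨n₀, hn₀⟩ := exists_pow_mul_monomial (ι := ι) (Finset.univ.sup l)
  have hl (i : ι) : l i ≤ Finset.univ.sup l := Finset.le_sup (Finset.mem_univ i)
  have key (m : ι →₀ ℕ) : ∃ H : MvPolynomial ι K, n₀ ≤ m.degree → H.IsHomogeneous (m.degree + 1) ∧
      ∀ j, aeval (y j) H = aeval (y j) (monomial m (1 : K)) * s j := by
    by_cases hm : n₀ ≤ m.degree
    · obtain ⟨i, m', rfl⟩ := hn₀ m hm
      refine ⟨monomial m' 1 * X i ^ (Finset.univ.sup l - l i) * G i, fun _ => ⟨?_, fun j => ?_⟩⟩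
      · have h1 := ((isHomogeneous_monomial (1 : K) (rfl : m'.degree = _)).mul
          (isHomogeneous_X_pow i (Finset.univ.sup l - l i))).mul (hG i)
        convert h1 using 1
        rw [map_add, Finsupp.degree_single]
        have := hl i
        lia
      · have h2 : monomial (Finsupp.single i (Finset.univ.sup l) + m') (1 : K) =
            monomial m' 1 * X i ^ (Finset.univ.sup l - l i) * X i ^ l i := by
          rw [mul_assoc, ← pow_add, Nat.sub_add_cancel (hl i), X_pow_eq_monomial, monomial_mul,
            add_comm, one_mul]
        rw [h2]
        simp only [map_mul, map_pow, aeval_X, hGs]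
        ring
    · exact ⟨0, fun h => absurd h hm⟩
  choose H hH using key
  refine ⟨fun _ F => ∑ m ∈ F.support, C (F.coeff m) * H m, n₀, fun n hn F hF => ⟨?_, fun j => ?_⟩⟩
  · refine IsHomogeneous.sum _ _ _ fun m hm => ?_
    have hd : m.degree = n := by
      rw [Finsupp.degree_eq_weight_one]
      exact hF (mem_support_iff.mp hm)
    have := (isHomogeneous_C ι (F.coeff m)).mul (hH m (by lia)).1
    rwa [zero_add, hd] at this
  · conv_rhs => rw [F.as_sum]
    rw [map_sum, map_sum, Finset.sum_mul]
    refine Finset.sum_congr rfl fun m hm => ?_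
    have hd : m.degree = n := by
      rw [Finsupp.degree_eq_weight_one]
      exact hF (mem_support_iff.mp hm)
    rw [map_mul, (hH m (by lia)).2, ← mul_assoc, ← map_mul, C_mul_monomial, mul_one]

/-- Finite-dimensionality of the space of sections of `𝒪(1)` on a projective scheme. -/
theorem finite_of_homogeneousCoordinates [IsAlgClosed K] [Finite ι] {y : ∀ i : ι, ι → A i}
    (hy : ∀ i, y i i = 1) {H : Submodule K (∀ i, A i)}
    (h : ∀ s ∈ H, ∀ i, ∃ (n : ℕ) (G : MvPolynomial ι K), G.IsHomogeneous (n + 1) ∧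
      ∀ j, aeval (y j) G = y j i ^ n * s j) : Module.Finite K H := by
  have h' (s : H) := exists_represents (h s s.2)
  choose φ hφ using h'
  let I : Ideal (MvPolynomial ι K) := coordinateIdeal y
  -- The representative `φ s` is chosen arbitrarily, but it is unique modulo null maps, which makes
  -- `T` linear.
  let T : H →ₗ[K] _ ⧸ nullMaps I :=
    { toFun := fun s => (nullMaps I).mkQ (φ s)
      map_add' := fun s t => by
        rw [← map_add, Submodule.mkQ_apply, Submodule.mkQ_apply, Submodule.Quotient.eq]
        exact (hφ (s + t)).sub_mem ((hφ s).add (hφ t))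
      map_smul' := fun c s => by
        rw [RingHom.id_apply, ← map_smul, Submodule.mkQ_apply, Submodule.mkQ_apply,
          Submodule.Quotient.eq]
        exact (hφ (c • s)).sub_mem ((hφ s).smul c) }
  have hT : Function.Injective T := by
    rw [injective_iff_map_eq_zero]
    intro s hs
    exact Subtype.ext ((hφ s).eq_zero hy ((Submodule.Quotient.mk_eq_zero _).mp hs))
  have hW := finiteModulo_iff.mp (finiteModulo_gradedMaps I (homogeneousClosed_coordinateIdeal y) 1)
  have : Module.Finite K ((gradedMaps I 1).map (nullMaps I).mkQ) := Module.Finite.iff_fg.mpr hW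
  let T' := T.codRestrict ((gradedMaps I 1).map (nullMaps I).mkQ)
    fun s => Submodule.mem_map_of_mem (hφ s).mem_gradedMaps
  exact Module.Finite.of_injective T' fun s t hst => hT congr($(hst).1)

end HomogeneousCoordinates

/-! ## Homogeneous coordinates on a projective scheme -/

/-- Homogeneous coordinates for which the line bundle `M` is `𝒪(1)`: the open subset `U i` is the
affine open subset on which the coordinate `i` is invertible, and `y i j` is the quotient of the
coordinates `j` and `i`. -/
structure Coordinates {Y : Scheme.{0}} (f : Y ⟶ SpecC) (M : LineBundle Y) where
  y : ∀ i _j : M.ι, Γ(Y, M.U i)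
  g_eq : ∀ i j, (M.g i j : Γ(Y, M.U i ⊓ M.U j)) = res inf_le_left (y i j)
  affine : ∀ i, IsAffineOpen (M.U i)
  inf_eq : ∀ i j, M.U i ⊓ M.U j = Y.basicOpen (y i j)
  self : ∀ i, y i i = 1
  mul : ∀ (i j k : M.ι) (W : Y.Opens) (hi : W ≤ M.U i) (hj : W ≤ M.U j),
    res hi (y i j) * res hj (y j k) = res hi (y i k)
  generates : ∀ i (s : Γ(Y, M.U i)), ∃ F : MvPolynomial M.ι ℂ,
    F.eval₂ (const f (M.U i)) (y i) = s

namespace Coordinates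

open MvPolynomial

variable {Y : Scheme.{0}} {f : Y ⟶ SpecC} {M : LineBundle Y} (c : Coordinates f M)
include c

/-- On the chart `i` the section is given by a form `G` of degree `p`. On `U_i ∩ U_j`, where `s j =
y j i * s i`, the functions `y j i * G` and `y j i ^ p * s j` agree; on the affine chart `j` they
agree after multiplication by a power of `y j i`. As there are finitely many charts, one exponent
serves for all. -/
theorem exists_lift [Finite M.ι] {s : ∀ i, Γ(Y, M.U i)}
    (hs : ∀ i j, res inf_le_left (s i) = (M.g i j : Γ(Y, M.U i ⊓ M.U j)) * res inf_le_right (s j))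
    (i : M.ι) :
    ∃ (n : ℕ) (G : MvPolynomial M.ι ℂ), G.IsHomogeneous (n + 1) ∧
      ∀ j, G.eval₂ (const f (M.U j)) (c.y j) = c.y j i ^ n * s j := by
  have := Fintype.ofFinite M.ι
  obtain ⟨F, hF⟩ := c.generates i (s i)
  obtain ⟨p, G, hG, hGF⟩ := exists_isHomogeneous_aeval_eq (B := Fn f (M.U i)) (c.self i) F
  have hGs : G.eval₂ (const f (M.U i)) (c.y i) = s i := hGF.trans hF
  have key (j : M.ι) : ∃ n : ℕ, c.y j i ^ n * (c.y j i * G.eval₂ (const f (M.U j)) (c.y j) -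
      c.y j i ^ p * s j) = 0 := by
    refine exists_pow_mul_eq_zero_of_res_basicOpen_eq_zero_of_isAffineOpen Y (c.affine j) _ _ ?_
    have hj : Y.basicOpen (c.y j i) ≤ M.U j := Y.basicOpen_le _
    have hi : Y.basicOpen (c.y j i) ≤ M.U i := (c.inf_eq j i).ge.trans inf_le_right
    change res hj _ = 0
    have h1 : res hj (s j) = res hj (c.y j i) * res hi (s i) := by
      have := congrArg (res (c.inf_eq j i).ge) (hs j i)
      rw [map_mul, res_res, res_res, c.g_eq, res_res] at this
      exact this
    have h2 : res hj (G.eval₂ (const f (M.U j)) (c.y j)) =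
        res hj (c.y j i) ^ p * res hi (s i) := by
      rw [hom_eval₂, ← hGs, hom_eval₂]
      have h3 : (res hj).comp (const f (M.U j)) = (res hi).comp (const f (M.U i)) := by
        ext x
        exact (res_const f hj x).trans (res_const f hi x).symm
      rw [h3, ← ProjectiveSpace.eval₂_mul_of_isHomogeneous _ _ _ hG]
      congr 1
      funext b
      exact (c.mul j i b _ hj hi).symm
    rw [map_sub, map_mul, map_mul, h1, h2, map_pow]
    ring
  choose n hn using key
  refine ⟨Finset.univ.sup n + p, X i ^ (Finset.univ.sup n + 1) * G, ?_, fun j => ?_⟩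
  · have := (isHomogeneous_X_pow (R := ℂ) i (Finset.univ.sup n + 1)).mul hG
    convert this using 1
    ring
  · have h1 : n j ≤ Finset.univ.sup n := Finset.le_sup (Finset.mem_univ j)
    have h2 := congrArg (c.y j i ^ (Finset.univ.sup n - n j) * ·) (hn j)
    simp only [mul_zero] at h2
    rw [← mul_assoc, ← pow_add, Nat.sub_add_cancel h1, mul_sub, sub_eq_zero] at h2
    rw [eval₂_mul, eval₂_pow, eval₂_X, pow_succ, mul_assoc, h2, pow_add, mul_assoc]

theorem finite [Finite M.ι] : Module.Finite ℂ (H0 f M) :=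
  finite_of_homogeneousCoordinates (A := fun i => Fn f (M.U i)) (y := c.y) c.self
    fun _ hs i => c.exists_lift hs i

/-- The coordinate of index `a` is a section, equal to `1` on the chart `a`, which is chosen to be
non-empty. -/
theorem nontrivial [Nonempty Y] : Nontrivial (H0 f M) := by
  obtain ⟨t⟩ := ‹Nonempty Y›
  obtain ⟨a, ha⟩ : ∃ a, t ∈ M.U a := by
    have : t ∈ ⨆ i, M.U i := by
      rw [M.iSup_U]
      trivial
    exact TopologicalSpace.Opens.mem_iSup.mp this
  refine ⟨⟨fun i => c.y i a, fun i j => ?_⟩, 0, fun h => ?_⟩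
  · rw [c.g_eq]
    exact (c.mul i j a _ inf_le_left inf_le_right).symm
  · have h1 : c.y a a = 0 := congrFun congr($(h).1) a
    rw [c.self] at h1
    have : Nonempty (M.U a) := ⟨⟨t, ha⟩⟩
    have : Nontrivial Γ(Y, M.U a) := inferInstance
    exact one_ne_zero h1

end Coordinates

/-! ## Isomorphisms of line bundles and sections -/

theorem eq_of_res_eq {X : Scheme.{0}} {ι : Type} {V : ι → X.Opens} {W : X.Opens}
    (hV : ∀ i, V i ≤ W) (hW : W ≤ ⨆ i, V i) {s t : Γ(X, W)} (h : ∀ i, res (hV i) s = res (hV i) t) :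
    s = t :=
  TopCat.Sheaf.eq_of_locally_eq' X.sheaf V W (fun i => homOfLE (hV i)) hW s t h

theorem existsUnique_of_res_eq {X : Scheme.{0}} {ι : Type} {V : ι → X.Opens} {W : X.Opens}
    (hV : ∀ i, V i ≤ W) (hW : W ≤ ⨆ i, V i) (s : ∀ i, Γ(X, V i))
    (h : ∀ i j, res (inf_le_left : V i ⊓ V j ≤ V i) (s i) = res inf_le_right (s j)) :
    ∃! t : Γ(X, W), ∀ i, res (hV i) t = s i :=
  TopCat.Sheaf.existsUnique_gluing' X.sheaf V W (fun i => homOfLE (hV i)) hW s h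

theorem eq_mul_of_eq_mul_inv {B : Type*} [CommRing B] {a a' b b' g : B} (h : a = g * a')
    (hb : a * b = 1) (hb' : a' * b' = 1) : b' = b * g := by
  linear_combination (-b') * hb + b * b' * h + b * g * hb'

namespace LineBundle

variable {X Y : Scheme.{0}}

theorem inf_iSup_U (L : LineBundle X) (W : X.Opens) : W ≤ ⨆ i, W ⊓ L.U i := by
  rw [← inf_iSup_eq, L.iSup_U, inf_top_eq]

namespace Iso

variable {L M : LineBundle X}

/-- The pull-back of an isomorphism of line bundles. -/
def pullback (η : Iso L M) (f : Y ⟶ X) : Iso (L.pullback f) (M.pullback f) where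
  h i j := Units.map (FanoStability.pull f (V := L.U i ⊓ M.U j) (W := f ⁻¹ᵁ L.U i ⊓ f ⁻¹ᵁ M.U j)
    (le_preimage_inf inf_le_left inf_le_right) :
    Γ(X, L.U i ⊓ M.U j) →* Γ(Y, f ⁻¹ᵁ L.U i ⊓ f ⁻¹ᵁ M.U j)) (η.h i j)
  left i i' j W hi hi' hj := by
    have h := congrArg (pull f (W := W) (le_preimage_inf (le_preimage_inf hi hi') hj))
      (η.left i i' j (L.U i ⊓ L.U i' ⊓ M.U j) (inf_le_left.trans inf_le_left)
        (inf_le_left.trans inf_le_right) inf_le_right)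
    rw [map_mul, pull_res, pull_res, pull_res] at h
    refine (res_pull f _ _ _).trans (h.trans ?_)
    exact (congrArg₂ (· * ·) (res_pull f _ _ _) (res_pull f _ _ _)).symm
  right i j j' W hi hj hj' := by
    have h := congrArg (pull f (W := W) (le_preimage_inf (le_preimage_inf hi hj) hj'))
      (η.right i j j' (L.U i ⊓ M.U j ⊓ M.U j') (inf_le_left.trans inf_le_left)
        (inf_le_left.trans inf_le_right) inf_le_right)
    rw [map_mul, pull_res, pull_res, pull_res] at h
    refine (res_pull f _ _ _).trans (h.trans ?_)
    exact (congrArg₂ (· * ·) (res_pull f _ _ _) (res_pull f _ _ _)).symm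

/-- The inverse of an isomorphism of line bundles. -/
def symm (η : Iso L M) : Iso M L where
  h j i := Units.map (RingHom.toMonoidHom (res (V := L.U i ⊓ M.U j) (W := M.U j ⊓ L.U i)
    (le_inf inf_le_right inf_le_left))) (η.h i j)⁻¹
  left j j' i W hj hj' hi := by
    have hu (k : M.ι) (hk : W ≤ M.U k) : res (le_inf hi hk) (η.h i k : Γ(X, L.U i ⊓ M.U k)) *
        res (le_inf hi hk) ((η.h i k)⁻¹ : Γ(X, L.U i ⊓ M.U k)ˣ) = 1 := by
      rw [← map_mul, Units.mul_inv, map_one]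
    refine (res_res _ _ _).trans (.trans ?_ (congrArg (· * _) (res_res _ _ _)).symm)
    exact eq_mul_of_eq_mul_inv (η.right i j j' W hi hj hj') (hu j hj) (hu j' hj')
  right j i i' W hj hi hi' := by
    have hu (k : L.ι) (hk : W ≤ L.U k) : res (le_inf hk hj) (η.h k j : Γ(X, L.U k ⊓ M.U j)) *
        res (le_inf hk hj) ((η.h k j)⁻¹ : Γ(X, L.U k ⊓ M.U j)ˣ) = 1 := by
      rw [← map_mul, Units.mul_inv, map_one]
    refine (res_res _ _ _).trans (.trans ?_ (congrArg (_ * ·) (res_res _ _ _)).symm)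
    refine .trans ?_ (mul_comm _ _)
    exact eq_mul_of_eq_mul_inv ((η.left i i' j W hi hi' hj).trans (mul_comm _ _)) (hu i' hi')
      (hu i hi)

/-- The section `t` of `M` corresponds to the section `s` of `L`. -/
def Related (η : Iso L M) (s : ∀ i, Γ(X, L.U i)) (t : ∀ j, Γ(X, M.U j)) : Prop :=
  ∀ i j, res inf_le_right (t j) = (η.h i j : Γ(X, L.U i ⊓ M.U j)) * res inf_le_left (s i)

namespace Related

variable {η : Iso L M} {s s' : ∀ i, Γ(X, L.U i)} {t t' : ∀ j, Γ(X, M.U j)}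

theorem res_eq (h : η.Related s t) {i : L.ι} {j : M.ι} {W : X.Opens} (hi : W ≤ L.U i)
    (hj : W ≤ M.U j) : res hj (t j) =
      res (le_inf hi hj) (η.h i j : Γ(X, L.U i ⊓ M.U j)) * res hi (s i) := by
  have := congrArg (res (le_inf hi hj)) (h i j)
  rwa [map_mul, res_res, res_res] at this

theorem right_unique (h : η.Related s t) (h' : η.Related s t') : t = t' := by
  funext j
  refine eq_of_res_eq (V := fun i => M.U j ⊓ L.U i) (fun i => inf_le_left) (L.inf_iSup_U _)
    fun i => ?_
  exact (h.res_eq inf_le_right inf_le_left).trans (h'.res_eq inf_le_right inf_le_left).symm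

theorem left_unique (h : η.Related s t) (h' : η.Related s' t) : s = s' := by
  funext i
  refine eq_of_res_eq (V := fun j => L.U i ⊓ M.U j) (fun j => inf_le_left) (M.inf_iSup_U _)
    fun j => ?_
  exact (η.h i j).isUnit.mul_left_cancel ((h i j).symm.trans (h' i j))

end Related

/-- The functions `h i j * s i` on `U_L i ∩ U_M j` agree for varying `i` by `η.left`, hence glue
over `U_M j`; by `η.right` the results satisfy the transition rule of `M`. -/
theorem exists_related (η : Iso L M) {s : ∀ i, Γ(X, L.U i)}
    (hs : ∀ i j, res inf_le_left (s i) = (L.g i j : Γ(X, L.U i ⊓ L.U j)) * res inf_le_right (s j)) :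
    ∃ t : ∀ j, Γ(X, M.U j), (∀ i j, res inf_le_left (t i) =
      (M.g i j : Γ(X, M.U i ⊓ M.U j)) * res inf_le_right (t j)) ∧ η.Related s t := by
  have hs' (i i' : L.ι) {W : X.Opens} (hi : W ≤ L.U i) (hi' : W ≤ L.U i') : res hi (s i) =
      res (le_inf hi hi') (L.g i i' : Γ(X, L.U i ⊓ L.U i')) * res hi' (s i') := by
    have := congrArg (res (le_inf hi hi')) (hs i i')
    rwa [map_mul, res_res, res_res] at this
  have h (j : M.ι) : ∃ t : Γ(X, M.U j), ∀ i, res inf_le_right t =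
      (η.h i j : Γ(X, L.U i ⊓ M.U j)) * res inf_le_left (s i) := by
    refine (existsUnique_of_res_eq (V := fun i => L.U i ⊓ M.U j) (fun i => inf_le_right) ?_
      (fun i => (η.h i j : Γ(X, L.U i ⊓ M.U j)) * res inf_le_left (s i)) fun i i' => ?_).exists
    · rw [← iSup_inf_eq, L.iSup_U, top_inf_eq]
    · rw [map_mul, map_mul, res_res, res_res]
      have hi : L.U i ⊓ M.U j ⊓ (L.U i' ⊓ M.U j) ≤ L.U i := inf_le_left.trans inf_le_left
      have hi' : L.U i ⊓ M.U j ⊓ (L.U i' ⊓ M.U j) ≤ L.U i' := inf_le_right.trans inf_le_left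
      have hj : L.U i ⊓ M.U j ⊓ (L.U i' ⊓ M.U j) ≤ M.U j := inf_le_left.trans inf_le_right
      refine .trans (congrArg (_ * ·) (hs' i i' hi hi')) ?_
      refine .trans (mul_assoc _ _ _).symm (congrArg (· * _) (η.left i i' j _ hi hi' hj).symm)
  choose t ht using h
  have hη : η.Related s t := fun i j => ht j i
  refine ⟨t, fun j j' => ?_, hη⟩
  refine eq_of_res_eq (V := fun i => M.U j ⊓ M.U j' ⊓ L.U i) (fun i => inf_le_left)
    (L.inf_iSup_U _) fun i => ?_
  have hi : M.U j ⊓ M.U j' ⊓ L.U i ≤ L.U i := inf_le_right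
  have hj : M.U j ⊓ M.U j' ⊓ L.U i ≤ M.U j := inf_le_left.trans inf_le_left
  have hj' : M.U j ⊓ M.U j' ⊓ L.U i ≤ M.U j' := inf_le_left.trans inf_le_right
  rw [map_mul, res_res, res_res, hη.res_eq hi hj, hη.res_eq hi hj', ← mul_assoc]
  exact congrArg (· * _) (η.right i j j' _ hi hj hj')

/-- Isomorphic line bundles have the same global sections. -/
theorem exists_linearMap (η : Iso L M) (f : X ⟶ SpecC) :
    ∃ T : H0 f L →ₗ[ℂ] H0 f M, Function.Injective T := by
  have h (s : H0 f L) : ∃ t : H0 f M, η.Related s.1 t.1 := by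
    obtain ⟨t, ht, h⟩ := η.exists_related s.2
    exact ⟨⟨t, ht⟩, h⟩
  choose T hT using h
  refine ⟨⟨⟨T, fun s s' => Subtype.ext ((hT _).right_unique ?_)⟩,
    fun a s => Subtype.ext ((hT _).right_unique ?_)⟩, fun s s' hs => Subtype.ext ?_⟩
  · intro i j
    refine (map_add (res inf_le_right) _ _).trans
      ((congrArg₂ (· + ·) (hT s i j) (hT s' i j)).trans ?_)
    exact (mul_add _ _ _).symm.trans (congrArg _ (map_add (res inf_le_left) _ _).symm)
  · intro i j
    refine (map_mul (res inf_le_right) (const f (M.U j) a) _).trans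
      ((congrArg₂ (· * ·) (res_const f _ a) (hT s i j)).trans ((mul_left_comm _ _ _).trans ?_))
    refine congrArg _ (.trans ?_ (map_mul (res inf_le_left) (const f (L.U i) a) _).symm)
    exact congrArg (· * _) (res_const f _ a).symm
  · have h1 := hT s'
    rw [← show T s = T s' from hs] at h1
    exact (hT s).left_unique h1

end Iso
end LineBundle

/-! ## Sections on the central fibre -/

namespace ProjectiveSpace

open MvPolynomial

variable {R : Type} [CommRing R] {N : ℕ} {Y Z : Scheme.{0}} (e : Y ⟶ ProjectiveSpace R N)
  (i : Z ⟶ Y)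

/-- The homogeneous coordinates on a closed subscheme of projective space. -/
theorem nonempty_coordinates [IsClosedImmersion e] [IsClosedImmersion i] {f : Z ⟶ SpecC}
    {φ : R →+* ℂ} (h : (i ≫ e) ≫ toBase R N = f ≫ Spec.map (CommRingCat.ofHom φ)) :
    Nonempty (Coordinates f (((O1 R N).pullback e).pullback i)) := by
  let z : Z ⟶ ProjectiveSpace R N := i ≫ e
  have hz : IsClosedImmersion z := inferInstance
  let y (a b : Fin (N + 1)) : Γ(Z, z ⁻¹ᵁ chart R N a) := pull z le_rfl (ratio R N a b)
  have hy {W : Z.Opens} {a : Fin (N + 1)} (ha : W ≤ z ⁻¹ᵁ chart R N a) (b : Fin (N + 1)) :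
      res ha (y a b) = pull z ha (ratio R N a b) := res_pull z le_rfl ha _
  refine ⟨⟨y, fun a b => ?_, fun a => (isAffineOpen_chart R N a).preimage z, fun a b => ?_,
    fun a => pull_ratio_self z le_rfl, fun a b c W ha hb => ?_, fun a s => ?_⟩⟩
  · refine .trans ?_ (hy inf_le_left b).symm
    refine (pull_pull i e (V := e ⁻¹ᵁ chart R N a ⊓ e ⁻¹ᵁ chart R N b)
      (U := chart R N a ⊓ chart R N b)
      (le_preimage_inf inf_le_left inf_le_right) (le_preimage_inf inf_le_left inf_le_right)
      (res inf_le_left (ratio R N a b))).trans ?_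
    exact pull_res z _ _ _
  · have h1 := congrArg (z ⁻¹ᵁ ·) (chart_inf_chart R N a b)
    refine Eq.trans ?_ (h1.trans ?_)
    · rfl
    · refine (Scheme.preimage_basicOpen z (ratio R N a b)).trans (congrArg _ ?_)
      exact congr($(Scheme.Hom.appLE_eq_app (f := z) (U := chart R N a)).hom _).symm
  · refine (congrArg₂ (· * ·) (hy ha b) (hy hb c)).trans (.trans ?_ (hy ha c).symm)
    exact pull_ratio_mul z c ha hb
  -- A function on an affine chart of the closed subscheme lifts to projective space, where it is a
  -- polynomial in the ratios over `R`; on `Z` the coefficients act through `φ`.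
  · obtain ⟨s', hs'⟩ := z.app_surjective (chart R N a) (isAffineOpen_chart R N a) s
    obtain ⟨F, hF⟩ := exists_eval₂_ratio R N a s'
    refine ⟨F.map φ, ?_⟩
    have hs'' : pull z le_rfl s' = s :=
      (congr($(Scheme.Hom.appLE_eq_app (f := z) (U := chart R N a)).hom s')).trans hs'
    refine Eq.trans ?_ hs''
    have hφ : (pull z le_rfl).comp (scalars (toBase R N) (chart R N a)) =
        (const f (z ⁻¹ᵁ chart R N a)).comp φ := by
      ext c
      refine (pull_scalars z (toBase R N) le_rfl c).trans ?_
      rw [show z ≫ toBase R N = _ from h]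
      exact scalars_comp_specMap f φ _ c
    have hF' := congrArg (pull z le_rfl) hF
    rw [hom_eval₂, hφ, ← eval₂_map] at hF'
    exact hF'

end ProjectiveSpace

instance (a : ℂ) : IsClosedImmersion (A1.pt a) :=
  IsClosedImmersion.spec_of_surjective _ fun c => ⟨Polynomial.C c, Polynomial.eval_C⟩

instance {Y : Scheme.{0}} (p : Y ⟶ A1) (a : ℂ) : IsClosedImmersion (fiberIncl p a) :=
  inferInstanceAs (IsClosedImmersion (Limits.pullback.fst p (A1.pt a)))

/-! ### Sections of a very ample line bundle on the fibres -/

section VeryAmple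

variable {Y : Scheme.{0}} {p : Y ⟶ A1} {L : LineBundle Y}

/-- The fibre is closed in the family, hence closed in projective space over `ℂ[t]`, and on it `t`
acts as the constant `a`. This gives complex coordinates without a base change of projective space.
-/
theorem VeryAmple.exists_coordinates (h : VeryAmple p L) (a : ℂ) :
    ∃ M : LineBundle (fiber p a), Finite M.ι ∧ Nonempty (Coordinates (fiberStr p a) M) ∧
      Nonempty (LineBundle.Iso M (L.pullback (fiberIncl p a))) := by
  obtain ⟨N, e, he, hep, ⟨η⟩⟩ := h
  refine ⟨_, inferInstanceAs (Finite (Fin (N + 1))),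
    ProjectiveSpace.nonempty_coordinates e (fiberIncl p a) (φ := Polynomial.evalRingHom a) ?_,
    ⟨η.pullback (fiberIncl p a)⟩⟩
  rw [Category.assoc, hep]
  exact fiber_condition p a

theorem VeryAmple.finite_H0 (h : VeryAmple p L) (a : ℂ) :
    Module.Finite ℂ (H0 (fiberStr p a) (L.pullback (fiberIncl p a))) := by
  obtain ⟨M, hM, ⟨c⟩, ⟨η⟩⟩ := h.exists_coordinates a
  obtain ⟨T, hT⟩ := η.symm.exists_linearMap (fiberStr p a)
  have := c.finite
  exact Module.Finite.of_injective T hT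

theorem VeryAmple.nontrivial_H0 (h : VeryAmple p L) (a : ℂ) [Nonempty (fiber p a)] :
    Nontrivial (H0 (fiberStr p a) (L.pullback (fiberIncl p a))) := by
  obtain ⟨M, hM, ⟨c⟩, ⟨η⟩⟩ := h.exists_coordinates a
  obtain ⟨T, hT⟩ := η.exists_linearMap (fiberStr p a)
  have := c.nontrivial
  exact hT.nontrivial

/-- The space of global sections on a non-empty fibre is finite-dimensional and non-zero. -/
theorem VeryAmple.h0_pos (h : VeryAmple p L) (a : ℂ) [Nonempty (fiber p a)] :
    0 < h0 (fiberStr p a) (L.pullback (fiberIncl p a)) := by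
  -- Finiteness is essential here, as `finrank` is `0` on an infinite-dimensional space.
  have := h.finite_H0 a
  have := h.nontrivial_H0 a
  exact Module.finrank_pos

end VeryAmple

/-- A flat proper family over the affine line with a non-empty fibre has only non-empty fibres. -/
theorem nonempty_fiber {Y : Scheme.{0}} (p : Y ⟶ A1) [Flat p] [IsProper p] {a : ℂ}
    (h : Nonempty (fiber p a)) (b : ℂ) : Nonempty (fiber p b) := by
  have hcl : IsClosed (Set.range p) := p.isClosedMap.isClosed_range
  have hgen : StableUnderGeneralization (Set.range p) := by
    rw [← Set.image_univ]
    exact (Flat.generalizingMap p).stableUnderGeneralization_image stableUnderGeneralization_univ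
  obtain ⟨x⟩ := h
  let η : A1 := genericPoint A1
  -- The image is stable under generalization by flatness, so it contains the generic point; being
  -- closed, it is then the whole line.
  have hη : η ∈ Set.range p := by
    refine hgen (genericPoint_specializes (p (fiberIncl p a x))) ⟨_, rfl⟩
  have hall (t : A1) : t ∈ Set.range p :=
    hcl.stableUnderSpecialization (genericPoint_specializes t) hη
  obtain ⟨s⟩ : Nonempty SpecC := inferInstance
  obtain ⟨y, hy⟩ := hall (A1.pt b s)
  obtain ⟨z, -, -⟩ := Scheme.Pullback.exists_preimage_pullback y s hy
  exact ⟨z⟩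

/-- The fibre over `1` is `X`, so it is non-empty, and hence so is the central fibre. -/
theorem TestConfiguration.N_pos {X : Scheme.{0}} {f : X ⟶ SpecC} {A : LineBundle X} {k : ℕ}
    [Nonempty X] (𝒯 : TestConfiguration f A k) {m : ℕ} (hm : 0 < m) : 0 < 𝒯.N m := by
  have := 𝒯.flat
  have := 𝒯.proper
  obtain ⟨x⟩ := ‹Nonempty X›
  have := nonempty_fiber 𝒯.proj (a := 1) ⟨𝒯.fiberIso.inv x⟩ 0
  exact (𝒯.veryAmple.pow hm).h0_pos 0

/-! ## Powers of a test configuration -/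

theorem LineBundle.ext_of_g {X : Scheme.{0}} {ι : Type} {U : ι → X.Opens} {hU : ⨆ i, U i = ⊤}
    {g g' : ∀ i j, Γ(X, U i ⊓ U j)ˣ} (h : g = g') {c c'} :
    (⟨ι, U, hU, g, c⟩ : LineBundle X) = ⟨ι, U, hU, g', c'⟩ := by
  subst h
  rfl

theorem LineBundle.pow_mul {X : Scheme.{0}} (L : LineBundle X) (m j : ℕ) :
    L.pow (m * j) = (L.pow m).pow j :=
  LineBundle.ext_of_g (funext fun a => funext fun b => _root_.pow_mul (L.g a b) m j)

/-- The power of an isomorphism of line bundles. -/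
def LineBundle.Iso.pow {X : Scheme.{0}} {L M : LineBundle X} (η : LineBundle.Iso L M) (m : ℕ) :
    LineBundle.Iso (L.pow m) (M.pow m) where
  h i j := η.h i j ^ m
  left i i' j W hi hi' hj := by
    refine (map_pow (res _) _ m).trans ((congrArg (· ^ m) (η.left i i' j W hi hi' hj)).trans ?_)
    exact (mul_pow _ _ m).trans
      (congrArg₂ (· * ·) (map_pow (res _) _ m).symm (map_pow (res _) _ m).symm)
  right i j j' W hi hj hj' := by
    refine (map_pow (res _) _ m).trans ((congrArg (· ^ m) (η.right i j j' W hi hj hj')).trans ?_)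
    exact (mul_pow _ _ m).trans
      (congrArg₂ (· * ·) (map_pow (res _) _ m).symm (map_pow (res _) _ m).symm)

theorem LineBundle.pow_pullback {X Y : Scheme.{0}} (L : LineBundle X) (f : Y ⟶ X) (m : ℕ) :
    (L.pow m).pullback f = (L.pullback f).pow m :=
  LineBundle.ext_of_g (funext fun a => funext fun b => map_pow (Units.map _) (L.g a b) m)

namespace TestConfiguration

variable {X : Scheme.{0}} {f : X ⟶ SpecC} {L : LineBundle X} {k : ℕ}

/-- `L.pow (m * j)` and `(L.pow m).pow j` are equal but not definitionally so; their linearizations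
have different types and are compared by `HEq`. -/
theorem totalWeight_congr {Y : Scheme.{0}} {p : Y ⟶ A1} {ρ : GmAction (p ≫ A1.str)}
    (hρ : Equivariant ρ) {M M' : LineBundle Y} (h : M = M') {l : Linearization ρ M}
    {l' : Linearization ρ M'} (hl : HEq l l') :
    totalWeight (l.onCentralFiber hρ) = totalWeight (l'.onCentralFiber hρ) := by
  subst h
  rw [eq_of_heq hl]

end TestConfiguration

/-- The test configuration with the `m`-th power of the line bundle. -/
def TestConfiguration.pow {X : Scheme.{0}} {f : X ⟶ SpecC} {A : LineBundle X} {k : ℕ}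
    (𝒯 : TestConfiguration f A k) {m : ℕ} (hm : 0 < m) : TestConfiguration f A (k * m) where
  total := 𝒯.total
  proj := 𝒯.proj
  flat := 𝒯.flat
  proper := 𝒯.proper
  action := 𝒯.action
  equivariant := 𝒯.equivariant
  bundle := 𝒯.bundle.pow m
  linearization := 𝒯.linearization.pow m
  veryAmple := have := 𝒯.proper; 𝒯.veryAmple.pow hm
  fiberIso := 𝒯.fiberIso
  fiberIso_over := 𝒯.fiberIso_over
  bundleIso := by
    rw [LineBundle.pow_mul, LineBundle.pow_pullback, LineBundle.pow_pullback]
    exact 𝒯.bundleIso.pow m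

theorem Linearization.ext_of_h {Y : Scheme.{0}} {f : Y ⟶ SpecC} {ρ : GmAction f}
    {ι : Type} {U : ι → Y.Opens} {hU : ⨆ i, U i = ⊤}
    {g g' : ∀ i j, Γ(Y, U i ⊓ U j)ˣ} (h : g = g') {c c'}
    (l : Linearization ρ (⟨ι, U, hU, g, c⟩ : LineBundle Y))
    (l' : Linearization ρ (⟨ι, U, hU, g', c'⟩ : LineBundle Y))
    (hl : ∀ (i j : ι) (T : Scheme.{0}) (u : Γ(T, ⊤)ˣ) (x : T ⟶ Y) (hi : ⊤ ≤ x ⁻¹ᵁ U i)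
      (hj : ⊤ ≤ ρ.act u x ⁻¹ᵁ U j), l.h i j u x hi hj = l'.h i j u x hi hj) : HEq l l' := by
  subst h
  refine heq_of_eq ?_
  cases l
  cases l'
  congr
  funext i j T u x hi hj
  exact hl i j T u x hi hj

namespace TestConfiguration

variable {X : Scheme.{0}} {f : X ⟶ SpecC} {A : LineBundle X} {k : ℕ} (𝒯 : TestConfiguration f A k)
  {m : ℕ} (hm : 0 < m)

theorem N_pow (j : ℕ) : (𝒯.pow hm).N j = 𝒯.N (m * j) := by
  rw [N, N, LineBundle.pow_mul]
  rfl

theorem w_pow (j : ℕ) : (𝒯.pow hm).w j = 𝒯.w (m * j) := by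
  refine totalWeight_congr 𝒯.equivariant (LineBundle.pow_mul 𝒯.bundle m j).symm ?_
  exact Linearization.ext_of_h (funext fun a => funext fun b => (_root_.pow_mul _ m j).symm) _ _
    fun i i' T u x hi hj => (_root_.pow_mul _ m j).symm

theorem isProduct_pow : (𝒯.pow hm).IsProduct ↔ 𝒯.IsProduct := Iff.rfl

theorem isTrivial_pow : (𝒯.pow hm).IsTrivial ↔ 𝒯.IsTrivial := Iff.rfl

end TestConfiguration

/-! ## The asymptotics of the Chow weights -/

open Filter in
-- Because `k > 0`, the values at `k m` for large `m` are values at infinitely many points and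
-- determine the polynomial.
theorem expansion_eq {d k : ℕ} (hk : 0 < k) {F : ℕ → ℚ} {P : Polynomial ℚ} (hP : P.natDegree ≤ d)
    (h : ∀ᶠ m in atTop, F m = P.eval ((k * m : ℕ) : ℚ)) : expansion d k F = P := by
  have hex : ∃ P : Polynomial ℚ, P.natDegree ≤ d ∧ ∀ᶠ m in atTop, F m = P.eval ((k * m : ℕ) : ℚ) :=
    ⟨P, hP, h⟩
  rw [expansion, dif_pos hex]
  obtain ⟨m₀, hm₀⟩ := eventually_atTop.mp (hex.choose_spec.2.and h)
  refine Polynomial.eq_of_infinite_eval_eq _ _ (Set.infinite_of_injective_forall_mem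
    (f := fun m : ℕ => ((k * (m₀ + m) : ℕ) : ℚ)) (fun a b hab => ?_) fun m => ?_)
  · have := Nat.eq_of_mul_eq_mul_left hk (Nat.cast_injective hab)
    lia
  · have := hm₀ (m₀ + m) (by lia)
    exact this.1.symm.trans this.2

open Filter Topology in
-- Only `P` is known to have degree exactly `n`; if `D` has smaller degree, both sides are zero.
theorem tendsto_eval_div_eval {P D : Polynomial ℚ} {n : ℕ} (hP : P.natDegree ≤ n)
    (hD : D.natDegree ≤ n) (h : P.coeff n ≠ 0) :
    Tendsto (fun x => D.eval x / P.eval x) atTop (𝓝 (D.coeff n / P.coeff n)) := by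
  have hPn : P.natDegree = n := le_antisymm hP (Polynomial.le_natDegree_of_ne_zero h)
  have hP0 : P ≠ 0 := fun h0 => h (by rw [h0, Polynomial.coeff_zero])
  have hPd : P.degree = n := by rw [Polynomial.degree_eq_natDegree hP0, hPn]
  by_cases hc : D.coeff n = 0
  · rw [hc, zero_div]
    refine Polynomial.div_tendsto_atTop_zero_of_degree_lt _ _ ?_
    rw [hPd, Polynomial.degree_lt_iff_coeff_zero]
    intro m hm
    rcases hm.eq_or_lt with rfl | hm
    · exact hc
    · exact Polynomial.coeff_eq_zero_of_natDegree_lt (hD.trans_lt hm)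
  · have hDn : D.natDegree = n := le_antisymm hD (Polynomial.le_natDegree_of_ne_zero hc)
    have hD0 : D ≠ 0 := fun h0 => hc (by rw [h0, Polynomial.coeff_zero])
    have := Polynomial.div_tendsto_atTop_leadingCoeff_div_of_degree_eq D P
      (by rw [hPd, Polynomial.degree_eq_natDegree hD0, hDn])
    rwa [Polynomial.leadingCoeff, Polynomial.leadingCoeff, hDn, hPn] at this

namespace TestConfiguration

open Filter Topology

variable {X : Scheme.{0}} {f : X ⟶ SpecC} {A : LineBundle X} {k : ℕ} (𝒯 : TestConfiguration f A k)

/-- If the Donaldson-Futaki invariant does not vanish, then it is determined by the Chow weights of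
the powers of the test configuration. -/
theorem tendsto_Chow_pow (hk : 0 < k) {n : ℕ} (h : 𝒯.DF n ≠ 0) :
    Tendsto (fun m : ℕ => ((k * (m + 1) : ℕ) : ℚ) * (𝒯.pow m.succ_pos).Chow n) atTop
      (𝓝 (𝒯.DF n / 2)) := by
  -- Division by zero gives zero, so `DF ≠ 0` forces `a₀ ≠ 0`. Likewise neither expansion can be the
  -- default value `0`, and both polynomials exist.
  have ha : 𝒯.a₀ n ≠ 0 := fun ha => h (by rw [DF, ha]; simp)
  obtain ⟨P, hPd, hP⟩ : ∃ P : Polynomial ℚ, P.natDegree ≤ n ∧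
      ∀ᶠ m in atTop, (𝒯.N m : ℚ) = P.eval ((k * m : ℕ) : ℚ) := by
    by_contra hex
    exact ha (by rw [a₀, polyN, expansion, dif_neg hex, Polynomial.coeff_zero])
  obtain ⟨Q, hQd, hQ⟩ : ∃ Q : Polynomial ℚ, Q.natDegree ≤ n + 1 ∧
      ∀ᶠ m in atTop, (𝒯.w m : ℚ) = Q.eval ((k * m : ℕ) : ℚ) := by
    by_contra hex
    have h0 : 𝒯.polyW n = 0 := by rw [polyW, expansion, dif_neg hex]
    exact h (by rw [DF, b₀, b₁, h0]; simp)
  have hPN : 𝒯.polyN n = P := expansion_eq hk hPd hP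
  have hQW : 𝒯.polyW n = Q := expansion_eq hk hQd hQ
  have htop (m : ℕ) : Tendsto (fun j => (m + 1) * j) atTop atTop :=
    tendsto_id.const_mul_atTop' m.succ_pos
  -- The expansions are in `r = km`, not in `m`, so passing to a power only restricts them to a
  -- subsequence of arguments.
  have hPN' (m : ℕ) : (𝒯.pow m.succ_pos).polyN n = P := by
    refine expansion_eq (Nat.mul_pos hk m.succ_pos) hPd ?_
    filter_upwards [(htop m).eventually hP] with j hj
    rw [N_pow, hj, mul_assoc]
  have hQW' (m : ℕ) : (𝒯.pow m.succ_pos).polyW n = Q := by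
    refine expansion_eq (Nat.mul_pos hk m.succ_pos) hQd ?_
    filter_upwards [(htop m).eventually hQ] with j hj
    rw [w_pow, hj, mul_assoc]
  rw [a₀, hPN] at ha
  -- `D(r) = b₀ r N(r) - a₀ w(r)` is the numerator of `r · Chow_r` over `a₀ N(r)`. Its coefficient
  -- at `r ^ (n + 1)` is `b₀ a₀ - a₀ b₀ = 0`.
  let D : Polynomial ℚ := Polynomial.C (Q.coeff (n + 1)) * (Polynomial.X * P) -
    Polynomial.C (P.coeff n) * Q
  have hDc : D.coeff n = 𝒯.a₁ n * 𝒯.b₀ n - 𝒯.a₀ n * 𝒯.b₁ n := by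
    rw [a₁, a₀, b₀, b₁, hPN, hQW, Polynomial.coeff_sub, Polynomial.coeff_C_mul,
      Polynomial.coeff_C_mul]
    -- For `n = 0` the product `X * P` has no constant term, matching the convention `a₁ = 0`.
    rcases n with _ | n
    · simp
    · rw [Polynomial.coeff_X_mul, if_neg n.succ_ne_zero, Nat.add_sub_cancel, mul_comm]
  have hDd : D.natDegree ≤ n := by
    rw [Polynomial.natDegree_le_iff_coeff_eq_zero]
    intro m hm
    obtain ⟨m, rfl⟩ : ∃ j, m = j + 1 := ⟨m - 1, by lia⟩
    rw [Polynomial.coeff_sub, Polynomial.coeff_C_mul, Polynomial.coeff_C_mul,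
      Polynomial.coeff_X_mul]
    rcases (Nat.lt_succ_iff.mp hm).eq_or_lt with rfl | hm
    · ring
    · rw [Polynomial.coeff_eq_zero_of_natDegree_lt (p := P) (by lia),
        Polynomial.coeff_eq_zero_of_natDegree_lt (p := Q) (n := m + 1) (by lia)]
      ring
  have hr : Tendsto (fun m : ℕ => ((k * (m + 1) : ℕ) : ℚ)) atTop atTop :=
    tendsto_natCast_atTop_atTop.comp
      ((tendsto_add_atTop_nat 1).const_mul_atTop' hk)
  have hlim := ((tendsto_eval_div_eval hPd hDd ha).comp hr).const_mul (P.coeff n)⁻¹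
  have hval : (P.coeff n)⁻¹ * (D.coeff n / P.coeff n) = 𝒯.DF n / 2 := by
    rw [DF, ← hDc, a₀, hPN]
    field_simp
  rw [hval] at hlim
  refine hlim.congr' ?_
  have hP0 : P ≠ 0 := fun h0 => ha (by rw [h0, Polynomial.coeff_zero])
  -- For large `m` the level is also beyond the roots of `P`, so the division by `N(r)` is
  -- legitimate.
  filter_upwards [(tendsto_add_atTop_nat 1).eventually hP, (tendsto_add_atTop_nat 1).eventually hQ,
    hr.eventually (Polynomial.eventually_atTop_not_isRoot P hP0)] with m hPm hQm hm
  have hm' : P.eval ((k * (m + 1) : ℕ) : ℚ) ≠ 0 := hm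
  have hr0 : ((k * (m + 1) : ℕ) : ℚ) ≠ 0 := Nat.cast_ne_zero.mpr (Nat.mul_pos hk m.succ_pos).ne'
  rw [Chow, b₀, a₀, hPN', hQW', N_pow, w_pow, mul_one, hPm, hQm]
  simp only [Function.comp_apply, D, Polynomial.eval_sub, Polynomial.eval_mul, Polynomial.eval_C,
    Polynomial.eval_X]
  generalize ((k * (m + 1) : ℕ) : ℚ) = r at hr0 hm' ⊢
  field_simp

/-- The limit formula is available only for `DF ≠ 0`; the other case is trivial. -/
theorem DF_nonneg (hk : 0 < k) {n : ℕ} (h : ∀ᶠ m : ℕ in atTop, 0 ≤ (𝒯.pow m.succ_pos).Chow n) :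
    0 ≤ 𝒯.DF n := by
  by_cases h0 : 𝒯.DF n = 0
  · exact h0.ge
  · have := ge_of_tendsto (𝒯.tendsto_Chow_pow hk h0)
      (h.mono fun m hm => mul_nonneg (Nat.cast_nonneg _) hm)
    linarith

theorem DF_eq_zero (hk : 0 < k) {n : ℕ} (h : ∀ᶠ m : ℕ in atTop, (𝒯.pow m.succ_pos).Chow n = 0) :
    𝒯.DF n = 0 := by
  by_contra h0
  have := tendsto_nhds_unique_of_eventuallyEq (𝒯.tendsto_Chow_pow hk h0)
    (tendsto_const_nhds (x := (0 : ℚ))) (h.mono fun m hm => by simp only [hm, mul_zero])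
  exact h0 (by linarith)

end TestConfiguration

/-! ## Chow stability and F-stability -/

open Filter in
theorem eventually_pow {P : ℕ → Prop} {k₀ k : ℕ} (h : ∀ j ≥ k₀, P j) (hk : 0 < k) :
    ∀ᶠ m : ℕ in atTop, P (k * (m + 1)) := by
  filter_upwards [eventually_ge_atTop k₀] with m hm
  refine h _ (hm.trans (m.le_succ.trans ?_))
  exact Nat.le_mul_of_pos_left _ hk

section

variable {X : Scheme.{0}} {f : X ⟶ SpecC} {n : ℕ} {A : LineBundle X}

/-- The threshold is kept: F-stability at a level `k ≥ k₀` uses Chow stability at `k` and at large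
multiples of `k`. -/
theorem Asymptotically.mono {P Q : ℕ → Prop} (h : Asymptotically P)
    (hPQ : ∀ k₀, 0 < k₀ → (∀ k, k₀ ≤ k → P k) → ∀ k, k₀ ≤ k → Q k) : Asymptotically Q := by
  obtain ⟨k₀, hk₀, h⟩ := h
  exact ⟨k₀, hk₀, hPQ k₀ hk₀ h⟩

theorem TestConfiguration.DF_nonneg_of_chowSemistable {k₀ k : ℕ} (hk : 0 < k)
    (h : ∀ j ≥ k₀, ChowSemistableAt f n A j) (𝒯 : TestConfiguration f A k) : 0 ≤ 𝒯.DF n :=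
  𝒯.DF_nonneg hk ((eventually_pow h hk).mono fun _ hm => hm _)

theorem fSemistableAt_of_chowSemistableAt {k₀ k : ℕ} (hk₀ : 0 < k₀)
    (h : ∀ j ≥ k₀, ChowSemistableAt f n A j) (hk : k₀ ≤ k) : FSemistableAt f n A k := fun 𝒯 =>
  mul_nonneg (by positivity)
    (add_nonneg (𝒯.DF_nonneg_of_chowSemistable (hk₀.trans_le hk) h) (h k hk 𝒯))

/-- The common part of the arguments for polystability and stability, with the class `C` of product
or trivial configurations. -/
theorem fut_eq_zero_iff [Nonempty X] {C : ∀ {k : ℕ}, TestConfiguration f A k → Prop}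
    (hC : ∀ {k m : ℕ} (𝒯 : TestConfiguration f A k) (hm : 0 < m), C 𝒯 → C (𝒯.pow hm))
    {k₀ k : ℕ} (hk₀ : 0 < k₀) (h : ∀ j ≥ k₀, ChowSemistableAt f n A j)
    (h' : ∀ j ≥ k₀, ∀ 𝒯 : TestConfiguration f A j, 𝒯.Chow n = 0 ↔ C 𝒯) (hk : k₀ ≤ k)
    (𝒯 : TestConfiguration f A k) : 𝒯.Fut n = 0 ↔ C 𝒯 := by
  have hk' := hk₀.trans_le hk
  constructor
  · intro h0
    have h1 : (k * 𝒯.N 1 : ℚ) ≠ 0 := by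
      have := 𝒯.N_pos one_pos
      positivity
    -- Now `DF + Chow = 0` with both summands nonnegative, so the Chow weight vanishes.
    have h2 := (mul_eq_zero.mp h0).resolve_left h1
    have h3 := 𝒯.DF_nonneg_of_chowSemistable hk' h
    have h4 := h k hk 𝒯
    exact (h' k hk 𝒯).mp (by linarith)
  · intro hT
    -- All powers remain in the class, so their Chow weights vanish at every large level, and so
    -- does the limit `DF / 2`.
    have h1 := 𝒯.DF_eq_zero (n := n) hk'
      ((eventually_pow h' hk').mono fun m hm => (hm _).mpr (hC 𝒯 m.succ_pos hT))
    rw [TestConfiguration.Fut, h1, (h' k hk 𝒯).mpr hT, add_zero, mul_zero]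

end
end
end FanoStability

theorem theorem1p3 {X : AlgebraicGeometry.Scheme.{0}} (f : X ⟶ FanoStability.SpecC) (n : ℕ)
    (A : FanoStability.LineBundle X) (hX : FanoStability.IsFanoManifold f n A) :
    (FanoStability.Asymptotically (FanoStability.ChowPolystableAt f n A) →
      FanoStability.Asymptotically (FanoStability.FPolystableAt f n A)) ∧
    (FanoStability.Asymptotically (FanoStability.ChowStableAt f n A) →
      FanoStability.Asymptotically (FanoStability.FStableAt f n A)) ∧
    (FanoStability.Asymptotically (FanoStability.ChowSemistableAt f n A) →
      FanoStability.Asymptotically (FanoStability.FSemistableAt f n A)) := by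
  -- Connectedness includes that `X` is non-empty, which is what makes `N_k` positive.
  have := hX.connected
  refine ⟨fun h => h.mono fun k₀ hk₀ h k hk => ⟨?_, fun 𝒯 => ?_⟩,
    fun h => h.mono fun k₀ hk₀ h k hk => ⟨?_, fun 𝒯 => ?_⟩,
    fun h => h.mono fun k₀ hk₀ h k hk => ?_⟩
  · exact FanoStability.fSemistableAt_of_chowSemistableAt hk₀ (fun j hj => (h j hj).1) hk
  · exact FanoStability.fut_eq_zero_iff (C := fun 𝒯 => 𝒯.IsProduct)
      (fun 𝒯 hm => (𝒯.isProduct_pow hm).mpr) hk₀ (fun j hj => (h j hj).1)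
      (fun j hj => (h j hj).2) hk 𝒯
  · exact FanoStability.fSemistableAt_of_chowSemistableAt hk₀ (fun j hj => (h j hj).1) hk
  · exact FanoStability.fut_eq_zero_iff (C := fun 𝒯 => 𝒯.IsTrivial)
      (fun 𝒯 hm => (𝒯.isTrivial_pow hm).mpr) hk₀ (fun j hj => (h j hj).1)
      (fun j hj => (h j hj).2) hk 𝒯
  · exact FanoStability.fSemistableAt_of_chowSemistableAt hk₀ h hk
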